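/- Let $n\ge 5$ and let $C$ be a convex $n$-gon in the Euclidean plane with vertices $p_1,\dots,p_n$ in counterclockwise order, indices being understood modulo $n$. A convex polygon $Q$ (with any number of vertices) is *inscribed* in $C$ if every (closed) side of $C$ contains at least one vertex of $Q$. Let $\mathcal F(C)$ be the set of those convex polygons inscribed in $C$ whose perimeter is minimal among all convex polygons inscribed in $C$. For $Q$ inscribed in $C$ let $s(Q)\in\{U,N\}^n$ be the cyclic sequence whose $k$th element is $U$ if $p_k$ is a vertex of $Q$, and $N$ otherwise. Let $s\in\{U,N\}^n$. (i) If $n$ is odd or $s\ne NN\cdots N$, then there is at most one $Q\in\mathcal F(C)$ with $s(Q)=s$. (ii) If $n$ is even and $s=NN\cdots N$, then there are either no $Q\in\mathcal F(C)$ with $s(Q)=s$ or infinitely many. In the latter case, if $Q_1,Q_2\in\mathcal F(C)$ satisfy $s(Q_1)=s(Q_2)=s$, then all corresponding sides of $Q_1$ and $Q_2$ are parallel. Here each $Q_i$ has exactly $n$ vertices, one on each side of $C$, in the same cyclic order as the sides of $C$, and the side of $Q_1$ joining its vertices on $p_{k-1}p_k$ and $p_kp_{k+1}$ corresponds to the side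 of $Q_2$ joining its vertices on $p_{k-1}p_k$ and $p_kp_{k+1}$, for $k=1,\dots,n$. -/

import Mathlib

open scoped Affine

/-- The Euclidean plane. -/
abbrev Plane : Type := EuclideanSpace ℝ (Fin 2)

/-- The determinant of two plane vectors: positive iff `w` points to the left of `u`. -/
def planeDet (u w : Plane) : ℝ := u 0 * w 1 - u 1 * w 0

/-- A convex `m`-gon, given by its vertices in counterclockwise order, with indices mod `m`:
every vertex that is not an endpoint of the side from `vert i` to `vert (i + 1)` lies strictly
to the left of the directed line through that side. -/
structure ConvexPolygon (m : ℕ) where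
  three_le : 3 ≤ m
  vert : ZMod m → Plane
  ccw : ∀ i j : ZMod m, j ≠ i → j ≠ i + 1 →
    0 < planeDet (vert (i + 1) - vert i) (vert j - vert i)

namespace ConvexPolygon

/-- The convex region bounded by the polygon. It does not depend on which vertex is listed
first, so two polygons are the same iff their regions are equal. -/
def region {m : ℕ} (P : ConvexPolygon m) : Set Plane := convexHull ℝ (Set.range P.vert)

/-- The closed side of the polygon from `vert i` to `vert (i + 1)`. -/
def side {m : ℕ} (P : ConvexPolygon m) (i : ZMod m) : Set Plane :=
  segment ℝ (P.vert i) (P.vert (i + 1))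

/-- The line through the side from `vert i` to `vert (i + 1)`. -/
noncomputable def sideLine {m : ℕ} (P : ConvexPolygon m) (i : ZMod m) : AffineSubspace ℝ Plane :=
  line[ℝ, P.vert i, P.vert (i + 1)]

/-- The perimeter: the sum of the lengths of the sides. -/
noncomputable def perim {m : ℕ} (P : ConvexPolygon m) : ℝ :=
  haveI : NeZero m := ⟨by have := P.three_le; omega⟩
  ∑ i : ZMod m, dist (P.vert i) (P.vert (i + 1))

/-- `Q` is inscribed in `C`: every side of `C` contains at least one vertex of `Q`. -/
def IsInscribed {m n : ℕ} (Q : ConvexPolygon m) (C : ConvexPolygon n) : Prop :=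
  ∀ k : ZMod n, ∃ j : ZMod m, Q.vert j ∈ C.side k

/-- `Q` is a minimum perimeter convex polygon inscribed in `C`; the competitors are convex
polygons with any number of vertices. -/
def IsMinPerim {m n : ℕ} (Q : ConvexPolygon m) (C : ConvexPolygon n) : Prop :=
  Q.IsInscribed C ∧ ∀ (m' : ℕ) (Q' : ConvexPolygon m'), Q'.IsInscribed C → Q.perim ≤ Q'.perim

end ConvexPolygon

/-- The two letters of the associated sequences: `U` (used) and `N` (not used). -/
inductive UseLetter : Type
  | U : UseLetter
  | N : UseLetter

namespace ConvexPolygon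

open Classical in
/-- The cyclic sequence associated to `Q`: its `k`th element is `U` iff the `k`th vertex of `C`
is a vertex of `Q`. -/
noncomputable def assocSeq {m n : ℕ} (C : ConvexPolygon n) (Q : ConvexPolygon m) :
    ZMod n → UseLetter :=
  fun k => if C.vert k ∈ Set.range Q.vert then UseLetter.U else UseLetter.N

/-- The set of all minimum perimeter convex polygons inscribed in `C` (as convex regions) whose
associated sequence is `s`. -/
def minPerimWithSeq {n : ℕ} (C : ConvexPolygon n) (s : ZMod n → UseLetter) : Set (Set Plane) :=
  {R | ∃ (m : ℕ) (Q : ConvexPolygon m), Q.IsMinPerim C ∧ C.assocSeq Q = s ∧ Q.region = R}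

/-- `e` matches the sides of `C` with the vertices of `Q`, preserving the counterclockwise
cyclic orders, so that each vertex of `Q` lies on the side of `C` matched with it. The side of
`Q` from `Q.vert (e k)` to `Q.vert (e k + 1)` thus joins the sides `k` and `k + 1` of `C`. -/
def IsSideMatching {m n : ℕ} (C : ConvexPolygon n) (Q : ConvexPolygon m)
    (e : ZMod n ≃ ZMod m) : Prop :=
  ∀ k : ZMod n, e (k + 1) = e k + 1 ∧ Q.vert (e k) ∈ C.side k

end ConvexPolygon

/-!
A convex polygon inscribed in `C` is compared with the closed paths `q` that choose a point `q k`
on each side `k` of `C`, measured by `ConvexPolygon.pathLength`.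

* Vertices of an inscribed polygon `Q`, chosen on the successive sides of `C`, go around `Q` once
  (`exists_lift`), so the path through them is no longer than `Q`, and it is strictly shorter if a
  vertex of `Q` is missed (`pathLength_le_perim`, `surjective_of_perim_le`).
* Conversely, a minimal subfamily of the points of a path that still meets every side consists of
  the vertices of a convex polygon, in order, which is no longer than the path
  (`IsMinimalCover.exists_polygon`). Here `5 ≤ n` guarantees at least three vertices.

So the vertices of a minimum perimeter polygon are the points of a shortest path
(`IsMinPerim.isShortestPath`, `IsMinPerim.surjective`). The length is a convex function of the
path; hence along the segment between two shortest paths every triangle inequality is an equality,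
and corresponding steps of the two paths are parallel (`IsShortestPath.sameRay`). This expresses
the displacement between the paths on one side by that on the preceding one
(`IsShortestPath.displacement`). A common vertex of `C` makes the displacement vanish on one side
and then on all (`IsShortestPath.eq_of_eq`). If no vertex of `C` is used, the displacement changes
its sign from each side to the next, so that it vanishes if `n` is odd
(`IsShortestPath.eq_of_odd`).

If `n` is even and no vertex of `C` is used, then the law of reflection
(`IsShortestPath.reflection`), which is the vanishing of the first variation, makes the recursion
for the displacement close up (`IsShortestPath.exists_parallel_variation`). The resulting paths
have steps of unchanged direction whose lengths are affine in the parameter, and the total length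
is constant because its derivative vanishes (`IsShortestPath.exists_family`).
-/

/-! ### Orientation of point triples -/

/-- Twice the signed area of the triangle `a b c`: positive iff it is traversed
counterclockwise. -/
def orient (a b c : Plane) : ℝ := planeDet (b - a) (c - a)

lemma orient_eq (a b c : Plane) :
    orient a b c = (b 0 - a 0) * (c 1 - a 1) - (b 1 - a 1) * (c 0 - a 0) := by
  simp [orient, planeDet]

lemma orient_rotate (a b c : Plane) : orient a b c = orient b c a := by
  simp only [orient_eq]; ring

lemma orient_swap (a b c : Plane) : orient a b c = -orient a c b := by
  simp only [orient_eq]; ring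

lemma orient_self_left (a b : Plane) : orient a a b = 0 := by
  simp only [orient_eq]; ring

lemma orient_self_right (a b : Plane) : orient a b b = 0 := by
  simp only [orient_eq]; ring

lemma orient_lineMap (a b c d : Plane) (t : ℝ) :
    orient (a + t • (b - a)) c d = (1 - t) * orient a c d + t * orient b c d := by
  simp only [orient_eq, PiLp.add_apply, PiLp.sub_apply, PiLp.smul_apply, smul_eq_mul]; ring

lemma mem_segment_iff_add_smul {a b x : Plane} :
    x ∈ segment ℝ a b ↔ ∃ t : ℝ, 0 ≤ t ∧ t ≤ 1 ∧ x = a + t • (b - a) := by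
  rw [segment_eq_image']
  constructor
  · rintro ⟨t, ⟨h0, h1⟩, rfl⟩; exact ⟨t, h0, h1, rfl⟩
  · rintro ⟨t, h0, h1, rfl⟩; exact ⟨t, ⟨h0, h1⟩, rfl⟩

lemma orient_nonneg_of_mem_segment {a b x c d : Plane} (hx : x ∈ segment ℝ a b)
    (ha : 0 ≤ orient a c d) (hb : 0 ≤ orient b c d) : 0 ≤ orient x c d := by
  obtain ⟨t, h0, h1, rfl⟩ := mem_segment_iff_add_smul.1 hx
  rw [orient_lineMap]
  have : 0 ≤ 1 - t := by linarith
  positivity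

lemma orient_pos_of_mem_segment_left {a b x c d : Plane} (hx : x ∈ segment ℝ a b) (hne : x ≠ b)
    (ha : 0 < orient a c d) (hb : 0 ≤ orient b c d) : 0 < orient x c d := by
  obtain ⟨t, h0, h1, rfl⟩ := mem_segment_iff_add_smul.1 hx
  rw [orient_lineMap]
  have : 0 < 1 - t := by
    rcases h1.lt_or_eq with h | rfl
    · linarith
    · simp at hne
  positivity

lemma orient_pos_of_mem_segment_right {a b x c d : Plane} (hx : x ∈ segment ℝ a b) (hne : x ≠ a)
    (ha : 0 ≤ orient a c d) (hb : 0 < orient b c d) : 0 < orient x c d :=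
  orient_pos_of_mem_segment_left (segment_symm ℝ a b ▸ hx) hne hb ha

lemma orient_pos_of_mem_segment {a b x c d : Plane} (hx : x ∈ segment ℝ a b)
    (ha : 0 < orient a c d) (hb : 0 < orient b c d) : 0 < orient x c d := by
  by_cases h : x = b
  · rwa [h]
  · exact orient_pos_of_mem_segment_left hx h ha hb.le

/-- The strict triangle inequality for a nondegenerate triangle. -/
lemma dist_lt_of_orient_pos {a b c : Plane} (h : 0 < orient a b c) :
    dist a c < dist a b + dist b c := by
  refine lt_of_le_of_ne (dist_triangle a b c) fun heq => ?_
  obtain ⟨t, -, rfl⟩ := dist_add_dist_eq_iff.1 heq.symm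
  rw [orient_rotate, AffineMap.lineMap_apply, vsub_eq_sub, vadd_eq_add, add_comm,
    orient_lineMap, orient_self_left, ← orient_rotate, orient_self_left] at h
  simp at h

namespace ConvexPolygon

variable {m n : ℕ}

lemma neZero (P : ConvexPolygon m) : NeZero m := ⟨by have := P.three_le; omega⟩

/-! ### Orientation of the vertices of a convex polygon -/

lemma orient_side_pos (P : ConvexPolygon m) {i j : ZMod m} (h : j ≠ i) (h' : j ≠ i + 1) :
    0 < orient (P.vert i) (P.vert (i + 1)) (P.vert j) := P.ccw i j h h'

lemma natCast_ne {i j : ℕ} (hij : i < j) (hj : j < i + m) : (i : ZMod m) ≠ j := by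
  intro h
  have h1 : (m : ℤ) ∣ (j : ℤ) - i := by
    rw [← ZMod.intCast_zmod_eq_zero_iff_dvd]; push_cast; rw [h, sub_self]
  have h2 := Int.le_of_dvd (by omega) h1
  omega

lemma add_natCast_ne (a : ZMod m) {i j : ℕ} (hij : i < j) (hj : j < i + m) :
    a + (i : ZMod m) ≠ a + j := fun h => natCast_ne hij hj (add_left_cancel h)

lemma add_natCast_ne_self (a : ZMod m) {j : ℕ} (h0 : 0 < j) (hj : j < m) :
    a + (j : ZMod m) ≠ a := by
  have := add_natCast_ne a (i := 0) h0 (by omega)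
  simpa using this.symm

/-- Any three vertices of a convex polygon, taken in cyclic order, form a counterclockwise
triangle. Only triples containing a whole side are covered by the definition; the general case
follows by moving the last vertex along, using the three-term Plücker relation. -/
lemma orient_vert_pos (P : ConvexPolygon m) (a : ZMod m) {j k : ℕ} (h0 : 0 < j) (hjk : j < k)
    (hk : k < m) : 0 < orient (P.vert a) (P.vert (a + j)) (P.vert (a + k)) := by
  have base : ∀ k : ℕ, 1 < k → k < m →
      0 < orient (P.vert a) (P.vert (a + (1 : ℕ))) (P.vert (a + k)) := by
    intro k h1 h2
    have := P.orient_side_pos (i := a) (j := a + k) (add_natCast_ne_self a (by omega) h2)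
      (by simpa using (add_natCast_ne a (i := 1) h1 (by omega)).symm)
    simpa using this
  have step : ∀ k : ℕ, 0 < k → k + 1 < m →
      0 < orient (P.vert a) (P.vert (a + k)) (P.vert (a + (k + 1 : ℕ))) := by
    intro k h1 h2
    have := P.orient_side_pos (i := a + k) (j := a) (add_natCast_ne_self a h1 (by omega)).symm
      (by simpa [add_assoc] using (add_natCast_ne_self a (j := k + 1) (by omega) h2).symm)
    rw [orient_rotate]
    simpa [add_assoc] using this
  induction k, hjk using Nat.le_induction with
  | base => exact step j h0 hk
  | succ k hjk ih =>
    have hjk : j < k := hjk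
    have ih := ih (by omega)
    have hs := step k (by omega) hk
    rcases (show 1 ≤ j from h0).eq_or_lt with rfl | h1
    · exact base _ (by omega) hk
    have e1 := base j h1 (by omega)
    have e2 := base k (by omega) (by omega)
    have e3 := base (k + 1) (by omega) hk
    have pl : ∀ o u v w x : Plane, orient o u w * orient o v x =
        orient o u v * orient o w x + orient o u x * orient o v w := by
      intro o u v w x; simp only [orient_eq]; ring
    have := pl (P.vert a) (P.vert (a + (1 : ℕ))) (P.vert (a + j)) (P.vert (a + k))
      (P.vert (a + (k + 1 : ℕ)))
    refine pos_of_mul_pos_right (a := orient (P.vert a) (P.vert (a + (1 : ℕ))) (P.vert (a + k)))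
      ?_ e2.le
    rw [this]; positivity

lemma orient_vert_nonneg (P : ConvexPolygon m) (a : ZMod m) {i j k : ℕ} (hij : i ≤ j)
    (hjk : j ≤ k) (hk : k ≤ i + m) :
    0 ≤ orient (P.vert (a + i)) (P.vert (a + j)) (P.vert (a + k)) := by
  rcases hij.eq_or_lt with rfl | hij
  · rw [orient_self_left]
  rcases hjk.eq_or_lt with rfl | hjk
  · rw [orient_self_right]
  rcases hk.eq_or_lt with rfl | hk
  · rw [orient_rotate, Nat.cast_add, ZMod.natCast_self, add_zero, orient_self_right]
  · have := P.orient_vert_pos (a + i) (j := j - i) (k := k - i) (by omega) (by omega) (by omega)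
    rw [Nat.cast_sub hij.le, Nat.cast_sub (by omega)] at this
    simpa using this.le

lemma orient_vert_pos' (P : ConvexPolygon m) (a : ZMod m) {i j k : ℕ} (hij : i < j)
    (hjk : j < k) (hk : k < i + m) :
    0 < orient (P.vert (a + i)) (P.vert (a + j)) (P.vert (a + k)) := by
  have := P.orient_vert_pos (a + i) (j := j - i) (k := k - i) (by omega) (by omega) (by omega)
  rw [Nat.cast_sub hij.le, Nat.cast_sub (by omega)] at this
  simpa using this

lemma vert_injective (P : ConvexPolygon m) : Function.Injective P.vert := by
  intro i j h
  by_contra hne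
  have h3 := P.three_le
  by_cases h1 : j = i + 1
  · have := P.orient_vert_pos i (j := 1) (k := 2) (by omega) (by omega) (by omega)
    rw [Nat.cast_one, ← h1, ← h, orient_self_left] at this
    exact lt_irrefl _ this
  · have := P.orient_side_pos (Ne.symm hne) h1
    rw [← h, orient_rotate, orient_rotate, orient_self_left] at this
    exact lt_irrefl _ this

/-! ### Points on the sides of a convex polygon -/

lemma orient_eq_zero_of_mem_side (P : ConvexPolygon m) {i : ZMod m} {x : Plane}
    (hx : x ∈ P.side i) : orient (P.vert i) (P.vert (i + 1)) x = 0 := by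
  obtain ⟨t, -, -, rfl⟩ := mem_segment_iff_add_smul.1 hx
  rw [orient_rotate, orient_rotate, orient_lineMap, orient_self_left, orient_rotate,
    orient_self_right]
  simp

lemma left_mem_side (P : ConvexPolygon m) (i : ZMod m) : P.vert i ∈ P.side i :=
  left_mem_segment ℝ _ _

lemma right_mem_side (P : ConvexPolygon m) (i : ZMod m) : P.vert (i + 1) ∈ P.side i :=
  right_mem_segment ℝ _ _

lemma orient_side_nonneg (P : ConvexPolygon m) (i j : ZMod m) :
    0 ≤ orient (P.vert i) (P.vert (i + 1)) (P.vert j) := by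
  by_cases h : j = i
  · rw [h, orient_rotate, orient_rotate, orient_self_left]
  by_cases h' : j = i + 1
  · rw [h', orient_self_right]
  exact (P.orient_side_pos h h').le

/-- Two sides of a convex polygon can only meet in the common endpoint of neighbouring sides. -/
lemma eq_vert_of_mem_side (P : ConvexPolygon m) {i j : ZMod m} {x : Plane} (hij : i ≠ j)
    (hi : x ∈ P.side i) (hj : x ∈ P.side j) :
    (j = i + 1 ∧ x = P.vert j) ∨ (i = j + 1 ∧ x = P.vert i) := by
  have h0 := P.orient_eq_zero_of_mem_side hi
  rw [orient_rotate, orient_rotate] at h0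
  have hl : ∀ k, orient (P.vert k) (P.vert i) (P.vert (i + 1)) =
      orient (P.vert i) (P.vert (i + 1)) (P.vert k) := fun k => orient_rotate _ _ _
  by_cases h1 : j = i + 1
  · refine Or.inl ⟨h1, ?_⟩
    by_contra hne
    refine (orient_pos_of_mem_segment_right hj hne ?_ ?_).ne' h0
    · rw [hl]; exact P.orient_side_nonneg _ _
    · rw [hl]
      have := P.three_le
      have := P.orient_vert_pos i (j := 1) (k := 2) (by omega) (by omega) (by omega)
      rw [h1, add_assoc, one_add_one_eq_two]
      simpa using this
  · refine Or.inr ?_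
    have hp := P.orient_side_pos hij.symm h1
    by_cases h2 : i = j + 1
    · refine ⟨h2, ?_⟩
      by_contra hne
      refine (orient_pos_of_mem_segment_left hj (h2 ▸ hne) ?_ ?_).ne' h0
      · rw [hl]; exact hp
      · rw [hl]; exact P.orient_side_nonneg _ _
    · refine absurd h0 (orient_pos_of_mem_segment hj ?_ ?_).ne'
      · rw [hl]; exact hp
      · rw [hl]
        exact P.orient_side_pos (Ne.symm h2) fun h => hij (add_right_cancel h).symm

lemma vert_mem_side_iff (P : ConvexPolygon m) {i k : ZMod m} :
    P.vert i ∈ P.side k ↔ k = i ∨ i = k + 1 := by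
  constructor
  · intro h
    by_cases hk : i = k
    · exact Or.inl hk.symm
    · rcases P.eq_vert_of_mem_side hk (P.left_mem_side i) h with ⟨-, h2⟩ | ⟨h1, -⟩
      · exact absurd (P.vert_injective h2) hk
      · exact Or.inr h1
  · rintro (rfl | rfl)
    · exact P.left_mem_side _
    · exact P.right_mem_side _

/-- Points chosen on the sides of a convex polygon, one on each, are weakly in convex position. -/
lemma orient_nonneg_of_mem_side (C : ConvexPolygon n) {q : ZMod n → Plane}
    (hq : ∀ k, q k ∈ C.side k) (a : ZMod n) {j k : ℕ} (h0 : 0 < j) (hjk : j < k) (hk : k < n) :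
    0 ≤ orient (q a) (q (a + j)) (q (a + k)) := by
  have h : ∀ x y z : ℕ, x ≤ 1 → y ≤ 1 → z ≤ 1 → 0 ≤ orient (C.vert (a + x))
      (C.vert (a + (j + y : ℕ))) (C.vert (a + (k + z : ℕ))) := fun x y z hx hy hz =>
    C.orient_vert_nonneg a (by omega) (by omega) (by omega)
  have hq1 : q a ∈ segment ℝ (C.vert (a + (0 : ℕ))) (C.vert (a + (1 : ℕ))) := by
    simpa [side] using hq a
  have hq2 : ∀ j : ℕ, q (a + j) ∈
      segment ℝ (C.vert (a + (j + 0 : ℕ))) (C.vert (a + (j + 1 : ℕ))) := by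
    intro j; simpa [side, add_assoc] using hq (a + j)
  have h1 : ∀ y z : ℕ, y ≤ 1 → z ≤ 1 → 0 ≤ orient (q a)
      (C.vert (a + (j + y : ℕ))) (C.vert (a + (k + z : ℕ))) := fun y z hy hz =>
    orient_nonneg_of_mem_segment hq1 (h 0 y z (by omega) hy hz) (h 1 y z le_rfl hy hz)
  have h2 : ∀ z : ℕ, z ≤ 1 → 0 ≤ orient (q a) (q (a + j)) (C.vert (a + (k + z : ℕ))) := by
    intro z hz
    rw [orient_rotate]
    refine orient_nonneg_of_mem_segment (hq2 j) ?_ ?_ <;> rw [← orient_rotate]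
    · exact h1 0 z (by omega) hz
    · exact h1 1 z le_rfl hz
  rw [orient_rotate, orient_rotate]
  refine orient_nonneg_of_mem_segment (hq2 k) ?_ ?_ <;> rw [orient_rotate]
  · exact h2 0 (by omega)
  · exact h2 1 le_rfl

/-- If the third side lies at least two steps before the first, then three points on sides of a
convex polygon can only be collinear if two neighbours coincide or if the middle one lies on the
segment between the other two, these being the endpoints of its side. -/
lemma orient_pos_of_mem_side (C : ConvexPolygon n) {q : ZMod n → Plane}
    (hq : ∀ k, q k ∈ C.side k) (a : ZMod n) {j k : ℕ} (h0 : 0 < j) (hjk : j < k) (hk : k + 2 ≤ n)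
    (hab : q a ≠ q (a + j)) (hbc : q (a + j) ≠ q (a + k))
    (hred : ¬ (q a = C.vert (a + j) ∧ q (a + k) = C.vert (a + j + 1))) :
    0 < orient (q a) (q (a + j)) (q (a + k)) := by
  have hv : a + (j : ZMod n) + 1 = a + (j + 1 : ℕ) := by push_cast; ring
  rw [hv] at hred
  have hq1 : q a ∈ segment ℝ (C.vert (a + (0 : ℕ))) (C.vert (a + (1 : ℕ))) := by
    simpa [side] using hq a
  have hq2 : ∀ j : ℕ, q (a + j) ∈
      segment ℝ (C.vert (a + (j : ℕ))) (C.vert (a + (j + 1 : ℕ))) := by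
    intro j; simpa [side, add_assoc] using hq (a + j)
  have h1 : q a ≠ C.vert (a + j) → 0 < orient (q a) (C.vert (a + j)) (q (a + k)) := by
    intro hne
    have hz : ∀ z : ℕ, z ≤ 1 →
        0 < orient (q a) (C.vert (a + j)) (C.vert (a + (k + z : ℕ))) := by
      intro z hz
      by_cases h : q a = C.vert (a + (1 : ℕ))
      · have : j ≠ 1 := by rintro rfl; exact hne h
        rw [h]
        exact C.orient_vert_pos' a (by omega) (by omega) (by omega)
      · exact orient_pos_of_mem_segment_left hq1 h
          (C.orient_vert_pos' a (by omega) (by omega) (by omega))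
          (C.orient_vert_nonneg a (by omega) (by omega) (by omega))
    rw [orient_rotate, orient_rotate]
    refine orient_pos_of_mem_segment (hq2 k) ?_ ?_ <;> rw [orient_rotate]
    · exact hz 0 (by omega)
    · exact hz 1 le_rfl
  have h2 : q (a + k) ≠ C.vert (a + (j + 1 : ℕ)) →
      0 < orient (q a) (C.vert (a + (j + 1 : ℕ))) (q (a + k)) := by
    intro hne
    have hx : ∀ x : ℕ, x ≤ 1 →
        0 < orient (C.vert (a + x)) (C.vert (a + (j + 1 : ℕ))) (q (a + k)) := by
      intro x hx
      rw [orient_rotate, orient_rotate]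
      by_cases h : q (a + k) = C.vert (a + k)
      · have : k ≠ j + 1 := by rintro rfl; exact hne h
        rw [h, orient_rotate]
        exact C.orient_vert_pos' a (by omega) (by omega) (by omega)
      · refine orient_pos_of_mem_segment_right (hq2 k) h ?_ ?_ <;> rw [orient_rotate]
        · exact C.orient_vert_nonneg a (by omega) (by omega) (by omega)
        · exact C.orient_vert_pos' a (by omega) (by omega) (by omega)
    exact orient_pos_of_mem_segment hq1 (hx 0 (by omega)) (hx 1 le_rfl)
  rw [orient_rotate]
  by_cases hA : q a = C.vert (a + j)
  · refine orient_pos_of_mem_segment_right (hq2 j) (hA ▸ hab.symm) ?_ ?_ <;> rw [← orient_rotate]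
    · rw [hA, orient_self_left]
    · exact h2 fun h => hred ⟨hA, h⟩
  · by_cases hC : q (a + k) = C.vert (a + (j + 1 : ℕ))
    · refine orient_pos_of_mem_segment_left (hq2 j) (hC ▸ hbc) ?_ ?_ <;> rw [← orient_rotate]
      · exact h1 hA
      · rw [hC, orient_self_right]
    · refine orient_pos_of_mem_segment (hq2 j) ?_ ?_ <;> rw [← orient_rotate]
      · exact h1 hA
      · exact h2 hC

/-- `T` indexes a subfamily of the points `q k` that meets every side of `C`, and no member of
which can be omitted. -/
structure IsMinimalCover (C : ConvexPolygon n) (q : ZMod n → Plane) (T : Finset (ZMod n)) :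
    Prop where
  cover : ∀ i, ∃ k ∈ T, q k ∈ C.side i
  needed : ∀ k ∈ T, ∃ i, q k ∈ C.side i ∧ ∀ l ∈ T, q l ∈ C.side i → l = k

lemma exists_isMinimalCover (C : ConvexPolygon n) {q : ZMod n → Plane}
    (hq : ∀ k, q k ∈ C.side k) : ∃ T, C.IsMinimalCover q T := by
  classical
  have := C.neZero
  obtain ⟨T, hT, hmin⟩ := (Finset.univ.filter fun T : Finset (ZMod n) =>
    ∀ i, ∃ k ∈ T, q k ∈ C.side i).exists_min_image Finset.card
    ⟨Finset.univ, by simpa using fun i => ⟨i, hq i⟩⟩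
  simp only [Finset.mem_filter, Finset.mem_univ, true_and] at hT hmin
  refine ⟨T, hT, fun k hk => ?_⟩
  by_contra! hcon
  refine absurd (hmin (T.erase k) fun i => ?_) (not_le.2 (Finset.card_erase_lt_of_mem hk))
  obtain ⟨l, hl, hli⟩ := hT i
  by_cases hlk : l = k
  · obtain ⟨l', hl', hli', hne⟩ := hcon i (hlk ▸ hli)
    exact ⟨l', Finset.mem_erase.2 ⟨hne, hl'⟩, hli'⟩
  · exact ⟨l, Finset.mem_erase.2 ⟨hlk, hl⟩, hli⟩

namespace IsMinimalCover

variable {C : ConvexPolygon n} {q : ZMod n → Plane} {T : Finset (ZMod n)}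

lemma injOn (h : C.IsMinimalCover q T) {k l : ZMod n} (hk : k ∈ T) (hl : l ∈ T)
    (hkl : q k = q l) : k = l := by
  obtain ⟨i, hi, hu⟩ := h.needed k hk
  exact (hu l hl (hkl ▸ hi)).symm

lemma not_redundant (h : C.IsMinimalCover q T) (hq : ∀ k, q k ∈ C.side k) {x y z : ZMod n}
    (hx : x ∈ T) (hy : y ∈ T) (hz : z ∈ T) (hxy : x ≠ y) (hyz : y ≠ z) :
    ¬ (q x = C.vert y ∧ q z = C.vert (y + 1)) := by
  rintro ⟨h1, h2⟩
  obtain ⟨i, hi, hu⟩ := h.needed y hy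
  by_cases hiy : i = y
  · exact hxy (hu x hx (by rw [h1, hiy]; exact C.left_mem_side y))
  · rcases C.eq_vert_of_mem_side (Ne.symm hiy) (hq y) hi with ⟨h3, h4⟩ | ⟨h3, h4⟩
    · exact hyz (h.injOn hy hz (by rw [h4, h2, h3]))
    · exact hxy (h.injOn hx hy (by rw [h4, h1]))

lemma orient_pos (h : C.IsMinimalCover q T) (hq : ∀ k, q k ∈ C.side k) (hn : 4 ≤ n)
    {a : ZMod n} {j k : ℕ} (h0 : 0 < j) (hjk : j < k) (hk : k < n) (ha : a ∈ T)
    (hj : a + j ∈ T) (hk' : a + k ∈ T) : 0 < orient (q a) (q (a + j)) (q (a + k)) := by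
  -- a triple whose last gap has length at least two
  have key : ∀ {a : ZMod n} {j k : ℕ} (h0 : 0 < j) (hjk : j < k) (hk : k + 2 ≤ n) (ha : a ∈ T)
      (hj : a + j ∈ T) (hk' : a + k ∈ T), 0 < orient (q a) (q (a + j)) (q (a + k)) := by
    intro a j k h0 hjk hk ha hj hk'
    have n1 := (add_natCast_ne_self a h0 (by omega)).symm
    have n2 := add_natCast_ne a hjk (by omega)
    exact C.orient_pos_of_mem_side hq a h0 hjk hk (fun e => n1 (h.injOn ha hj e))
      (fun e => n2 (h.injOn hj hk' e)) (h.not_redundant hq ha hj hk' n1 n2)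
  -- one of the three cyclic gaps has length at least two
  by_cases c1 : k + 2 ≤ n
  · exact key h0 hjk c1 ha hj hk'
  have e1 : a + (j : ZMod n) + (k - j : ℕ) = a + k := by
    rw [Nat.cast_sub hjk.le]; ring
  have e2 : a + (j : ZMod n) + (n - j : ℕ) = a := by
    rw [Nat.cast_sub (by omega), ZMod.natCast_self]; ring
  have e3 : a + (k : ZMod n) + (n - k : ℕ) = a := by
    rw [Nat.cast_sub (by omega), ZMod.natCast_self]; ring
  have e4 : a + (k : ZMod n) + (n - k + j : ℕ) = a + j := by
    rw [Nat.cast_add, ← add_assoc, e3]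
  by_cases c2 : 2 ≤ j
  · have := key (a := a + j) (j := k - j) (k := n - j) (by omega) (by omega) (by omega) hj
      (by rwa [e1]) (by rwa [e2])
    rw [e1, e2] at this
    rwa [orient_rotate]
  · have := key (a := a + k) (j := n - k) (k := n - k + j) (by omega) (by omega) (by omega) hk'
      (by rwa [e3]) (by rwa [e4])
    rw [e3, e4] at this
    rwa [orient_rotate, orient_rotate]

/-- Every point lies on at most two sides, so five sides need three points. -/
lemma three_le_card (h : C.IsMinimalCover q T) (hq : ∀ k, q k ∈ C.side k) (hn : 5 ≤ n) :
    3 ≤ T.card := by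
  classical
  have := C.neZero
  have h1 : (Finset.univ : Finset (ZMod n)) ⊆
      T.biUnion fun k => Finset.univ.filter fun i => q k ∈ C.side i := by
    intro i _
    obtain ⟨k, hk, hki⟩ := h.cover i
    simpa using ⟨k, hk, hki⟩
  have h2 : ∀ k ∈ T, (Finset.univ.filter fun i => q k ∈ C.side i).card ≤ 2 := by
    intro k _
    by_cases hp : q k = C.vert k
    · refine (Finset.card_le_card (t := {k, k - 1}) fun i hi => ?_).trans Finset.card_le_two
      have := C.vert_mem_side_iff.1 (hp ▸ (Finset.mem_filter.1 hi).2)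
      rcases this with rfl | rfl <;> simp
    · refine (Finset.card_le_card (t := {k, k + 1}) fun i hi => ?_).trans Finset.card_le_two
      by_cases hik : k = i
      · simp [hik]
      rcases C.eq_vert_of_mem_side hik (hq k) (Finset.mem_filter.1 hi).2 with ⟨h, -⟩ | ⟨-, h⟩
      · simp [h]
      · exact absurd h hp
  have h3 := (Finset.card_le_card h1).trans (Finset.card_biUnion_le.trans
    (Finset.sum_le_card_nsmul _ _ _ h2))
  rw [Finset.card_univ, ZMod.card, smul_eq_mul] at h3
  omega

end IsMinimalCover

end ConvexPolygon

/-! ### Lengths of closed polygonal paths -/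

section Path

variable {X : Type*} [PseudoMetricSpace X]

lemma sum_sum_Ico_of_monotone (g : ℕ → ℝ) (s : ℕ → ℕ) (n : ℕ) (hs : ∀ l < n, s l ≤ s (l + 1)) :
    s 0 ≤ s n ∧ ∑ l ∈ Finset.range n, ∑ i ∈ Finset.Ico (s l) (s (l + 1)), g i =
      ∑ i ∈ Finset.Ico (s 0) (s n), g i := by
  induction n with
  | zero => simp
  | succ n ih =>
    obtain ⟨h1, h2⟩ := ih fun l hl => hs l (by omega)
    have h3 := hs n (by omega)
    exact ⟨h1.trans h3, by rw [Finset.sum_range_succ, h2, Finset.sum_Ico_consecutive _ h1 h3]⟩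

lemma sum_Ico_of_periodic {g : ℕ → ℝ} {m : ℕ} (hg : Function.Periodic g m) (a : ℕ) :
    ∑ i ∈ Finset.Ico a (a + m), g i = ∑ i ∈ Finset.range m, g i := by
  induction a with
  | zero => simp
  | succ a ih =>
    rw [← ih]
    rcases Nat.eq_zero_or_pos m with rfl | hm
    · simp
    rw [Finset.sum_eq_sum_Ico_succ_bot (by omega : a < a + m), add_right_comm,
      Finset.sum_Ico_succ_top (by omega), hg a, add_comm]

/-- Going once around a closed path along a subsequence of its vertices does not increase the
length. -/
lemma sum_dist_subpath_le {f : ℕ → X} {m n : ℕ} (hf : Function.Periodic f m) {s : ℕ → ℕ}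
    (hs : ∀ l < n, s l ≤ s (l + 1)) (hn : s n = s 0 + m) :
    ∑ l ∈ Finset.range n, dist (f (s l)) (f (s (l + 1))) ≤
      ∑ i ∈ Finset.range m, dist (f i) (f (i + 1)) := by
  have hg : Function.Periodic (fun i => dist (f i) (f (i + 1))) m := fun i => by
    simp only [hf i, add_right_comm i m 1, hf (i + 1)]
  rw [← sum_Ico_of_periodic hg (s 0), ← hn, ← (sum_sum_Ico_of_monotone _ s n hs).2]
  exact Finset.sum_le_sum fun l hl => dist_le_Ico_sum_dist f (hs l (Finset.mem_range.1 hl))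

/-- If the path turns strictly at every vertex and a subpath is no shorter, then the subpath
leaves out no vertex. -/
lemma le_succ_of_sum_dist_subpath {f : ℕ → X} {m n : ℕ} (hf : Function.Periodic f m) {s : ℕ → ℕ}
    (hs : ∀ l < n, s l ≤ s (l + 1)) (hn : s n = s 0 + m)
    (hlt : ∀ i, dist (f i) (f (i + 2)) < dist (f i) (f (i + 1)) + dist (f (i + 1)) (f (i + 2)))
    (hle : ∑ i ∈ Finset.range m, dist (f i) (f (i + 1)) ≤
      ∑ l ∈ Finset.range n, dist (f (s l)) (f (s (l + 1)))) :
    ∀ l < n, s (l + 1) ≤ s l + 1 := by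
  intro l hl
  by_contra! hgap
  have hg : Function.Periodic (fun i => dist (f i) (f (i + 1))) m := fun i => by
    simp only [hf i, add_right_comm i m 1, hf (i + 1)]
  rw [← sum_Ico_of_periodic hg (s 0), ← hn, ← (sum_sum_Ico_of_monotone _ s n hs).2] at hle
  refine absurd hle (not_le.2 (Finset.sum_lt_sum (fun l hl => dist_le_Ico_sum_dist f
    (hs l (Finset.mem_range.1 hl))) ⟨l, Finset.mem_range.2 hl, ?_⟩))
  rw [Finset.sum_eq_sum_Ico_succ_bot (by omega), Finset.sum_eq_sum_Ico_succ_bot (by omega)]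
  have h1 := dist_le_Ico_sum_dist f (show s l + 2 ≤ s (l + 1) by omega)
  have h2 := dist_triangle (f (s l)) (f (s l + 2)) (f (s (l + 1)))
  have h3 := hlt (s l)
  rw [add_assoc (s l) 1 1, one_add_one_eq_two]
  linarith

end Path

namespace ConvexPolygon

variable {m n : ℕ}

lemma sum_zmod_eq_sum_range [NeZero n] (F : ZMod n → ℝ) (a : ZMod n) :
    ∑ i, F i = ∑ i ∈ Finset.range n, F (a + i) := by
  rw [← Equiv.sum_comp (Equiv.addLeft a) F]
  refine (Finset.sum_nbij (fun i : ℕ => (i : ZMod n)) (by simp) ?_ ?_ (by simp)).symm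
  · intro i hi j hj hij
    have := congrArg ZMod.val hij
    simpa [ZMod.val_cast_of_lt (Finset.mem_range.1 hi),
      ZMod.val_cast_of_lt (Finset.mem_range.1 hj)] using this
  · intro z _
    exact ⟨z.val, by simpa using ZMod.val_lt z, by simp⟩

lemma perim_eq_sum_range (P : ConvexPolygon m) (a : ZMod m) :
    P.perim = ∑ i ∈ Finset.range m, dist (P.vert (a + (i : ℕ))) (P.vert (a + (i + 1 : ℕ))) := by
  have := P.neZero
  refine (sum_zmod_eq_sum_range (fun i => dist (P.vert i) (P.vert (i + 1))) a).trans ?_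
  simp [add_assoc]

lemma val_add_one_of_lt [NeZero m] {i : ZMod m} (h : i.val + 1 < m) : (i + 1).val = i.val + 1 := by
  have : i + 1 = ((i.val + 1 : ℕ) : ZMod m) := by simp
  rw [this, ZMod.val_cast_of_lt h]

/-- The convex polygon with vertices `F 0, ..., F (m - 1)`, given that all triples of these are
traversed counterclockwise. -/
def ofSequence (F : ℕ → Plane) (hm : 3 ≤ m)
    (hF : ∀ i j k, i < j → j < k → k < m → 0 < orient (F i) (F j) (F k)) : ConvexPolygon m where
  three_le := hm
  vert i := F i.val
  ccw i j h h' := by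
    have : NeZero m := ⟨by omega⟩
    change 0 < orient (F i.val) (F (i + 1).val) (F j.val)
    have hj := ZMod.val_lt j
    have hi := ZMod.val_lt i
    have hne : j.val ≠ i.val := fun e => h (ZMod.val_injective m e)
    have hne' : j.val ≠ (i + 1).val := fun e => h' (ZMod.val_injective m e)
    by_cases hlt : i.val + 1 < m
    · rw [val_add_one_of_lt hlt] at hne' ⊢
      rcases lt_or_gt_of_ne hne with h1 | h1
      · rw [orient_rotate, orient_rotate]
        exact hF _ _ _ h1 (by omega) hlt
      · exact hF _ _ _ (by omega) (by omega) hj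
    · have : i + 1 = 0 := by
        have e : i + 1 = ((i.val + 1 : ℕ) : ZMod m) := by simp
        rw [e, show i.val + 1 = m by omega, ZMod.natCast_self]
      rw [this, ZMod.val_zero] at hne' ⊢
      rw [orient_rotate]
      exact hF _ _ _ (by omega) (by omega) hi

lemma ofSequence_vert_natCast {F : ℕ → Plane} (hm : 3 ≤ m)
    (hF : ∀ i j k, i < j → j < k → k < m → 0 < orient (F i) (F j) (F k)) (h0 : F m = F 0)
    {l : ℕ} (hl : l ≤ m) : (ofSequence F hm hF).vert l = F l := by
  change F (l : ZMod m).val = F l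
  rcases hl.lt_or_eq with h | rfl
  · rw [ZMod.val_cast_of_lt h]
  · simp [h0]

lemma perim_ofSequence {F : ℕ → Plane} (hm : 3 ≤ m)
    (hF : ∀ i j k, i < j → j < k → k < m → 0 < orient (F i) (F j) (F k)) (h0 : F m = F 0) :
    (ofSequence F hm hF).perim = ∑ i ∈ Finset.range m, dist (F i) (F (i + 1)) := by
  rw [perim_eq_sum_range _ 0]
  refine Finset.sum_congr rfl fun i hi => ?_
  have := Finset.mem_range.1 hi
  rw [zero_add, zero_add, ofSequence_vert_natCast hm hF h0 (by omega),
    ofSequence_vert_natCast hm hF h0 (by omega)]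

/-- The length of the closed path through the points `q k`. -/
noncomputable def pathLength [NeZero n] (q : ZMod n → Plane) : ℝ :=
  ∑ k, dist (q k) (q (k + 1))

/-- A minimal cover spans an inscribed convex polygon which is no longer than the path through
all the points. -/
lemma IsMinimalCover.exists_polygon [NeZero n] {C : ConvexPolygon n} {q : ZMod n → Plane}
    {T : Finset (ZMod n)} (h : C.IsMinimalCover q T) (hq : ∀ k, q k ∈ C.side k) (hn : 5 ≤ n) :
    ∃ (m : ℕ) (Q : ConvexPolygon m), Q.IsInscribed C ∧ Set.range Q.vert = q '' T ∧
      Q.perim ≤ pathLength q := by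
  classical
  have hinj : Set.InjOn (ZMod.val : ZMod n → ℕ) T := (ZMod.val_injective n).injOn
  obtain ⟨m, hm⟩ : ∃ m, (T.image ZMod.val).card = m := ⟨_, rfl⟩
  have hm3 : 3 ≤ m := by
    rw [← hm, Finset.card_image_of_injOn hinj]; exact h.three_le_card hq hn
  let e := (T.image ZMod.val).orderEmbOfFin hm
  let s : ℕ → ℕ := fun l => if hl : l < m then e ⟨l, hl⟩ else e ⟨0, by omega⟩ + n
  have hs : ∀ l (hl : l < m), s l = e ⟨l, hl⟩ := fun l hl => dif_pos hl
  have hsm : s m = s 0 + n := by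
    rw [hs 0 (by omega)]; exact dif_neg (lt_irrefl m)
  have hsT : ∀ l < m, (s l : ZMod n) ∈ T ∧ s l < n := by
    intro l hl
    have := Finset.orderEmbOfFin_mem (T.image ZMod.val) hm ⟨l, hl⟩
    obtain ⟨k, hk, hke⟩ := Finset.mem_image.1 this
    rw [hs l hl]
    constructor
    · rw [show e ⟨l, hl⟩ = k.val from hke.symm]; simpa using hk
    · rw [show e ⟨l, hl⟩ = k.val from hke.symm]; exact ZMod.val_lt k
  have hlt : ∀ i j, i < j → j < m → s i < s j := by
    intro i j hij hj
    rw [hs i (by omega), hs j hj]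
    exact e.strictMono (by simpa using hij)
  have hmono : ∀ l < m, s l ≤ s (l + 1) := by
    intro l hl
    by_cases h' : l + 1 < m
    · exact (hlt _ _ (by omega) h').le
    · have := (hsT l hl).2
      rw [show l + 1 = m by omega, hsm]; omega
  let F : ℕ → Plane := fun l => q (s l : ZMod n)
  have hF : ∀ i j k, i < j → j < k → k < m → 0 < orient (F i) (F j) (F k) := by
    intro i j k hij hjk hk
    have h1 := hlt i j hij (by omega)
    have h2 := hlt j k hjk hk
    have c1 : ((s i : ℕ) : ZMod n) + (s j - s i : ℕ) = s j := by
      rw [Nat.cast_sub h1.le]; ring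
    have c2 : ((s i : ℕ) : ZMod n) + (s k - s i : ℕ) = s k := by
      rw [Nat.cast_sub (by omega)]; ring
    have h3 := (hsT k hk).2
    have := h.orient_pos hq (by omega) (a := (s i : ZMod n)) (j := s j - s i) (k := s k - s i)
      (by omega) (by omega) (by omega) (hsT i (by omega)).1
      (by rw [c1]; exact (hsT j (by omega)).1) (by rw [c2]; exact (hsT k hk).1)
    rwa [c1, c2] at this
  have hF0 : F m = F 0 := by
    change q (s m : ZMod n) = q (s 0 : ZMod n)
    rw [hsm]; simp
  have hrange : Set.range (ofSequence F hm3 hF).vert = q '' T := by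
    have : NeZero m := ⟨by omega⟩
    ext x
    constructor
    · rintro ⟨i, rfl⟩
      exact ⟨_, (hsT i.val (ZMod.val_lt i)).1, rfl⟩
    · rintro ⟨k, hk, rfl⟩
      have : k.val ∈ Set.range e := by
        rw [Finset.range_orderEmbOfFin]
        simpa using ⟨k, hk, rfl⟩
      obtain ⟨i, hi⟩ := this
      refine ⟨(i.val : ZMod m), ?_⟩
      rw [ofSequence_vert_natCast hm3 hF hF0 i.2.le]
      change q (s i.val : ZMod n) = q k
      rw [hs _ i.2, Fin.eta, hi, ZMod.natCast_zmod_val]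
  refine ⟨m, ofSequence F hm3 hF, fun i => ?_, hrange, ?_⟩
  · obtain ⟨k, hk, hki⟩ := h.cover i
    obtain ⟨j, hj⟩ : q k ∈ Set.range (ofSequence F hm3 hF).vert := hrange ▸ ⟨k, hk, rfl⟩
    exact ⟨j, hj ▸ hki⟩
  · rw [perim_ofSequence hm3 hF hF0, pathLength, sum_zmod_eq_sum_range _ 0]
    have hper : Function.Periodic (fun l : ℕ => q (l : ZMod n)) n := fun l => by simp
    simpa using sum_dist_subpath_le hper hmono hsm

/-! ### Inscribed polygons and paths along the sides -/

/-- Vertices of `Q` chosen on the successive sides of `C` go around `Q` exactly once: their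
positions, counted from a suitable starting point, increase from `0` to `m`. The starting side
has to be one whose chosen vertex differs from that of the preceding side. -/
lemma exists_lift (hn : 5 ≤ n) {C : ConvexPolygon n} {Q : ConvexPolygon m} {g : ZMod n → ZMod m}
    (hg : ∀ k, Q.vert (g k) ∈ C.side k) :
    ∃ (a : ZMod n) (b : ℕ → ℕ), b 0 = 0 ∧ b n = m ∧ (∀ l < n, b l < m) ∧
      (∀ l < n, b l ≤ b (l + 1)) ∧ ∀ l ≤ n, g (a + l) = g a + b l := by
  have := C.neZero
  have := Q.neZero
  obtain ⟨a, ha⟩ : ∃ a, g (a + 1) ≠ g a := by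
    by_contra! hcon
    have h1 := hcon 0
    have h2 := hcon 1
    have h3 := hcon 2
    have e1 : (0 : ZMod n) + 1 = 1 := zero_add 1
    have e2 : (1 : ZMod n) + 1 = 2 := one_add_one_eq_two
    rw [e1] at h1; rw [e2] at h2
    have m0 := hg 0
    have m2 := hg 2
    rw [h2, h1] at m2
    have n0 : ((0 : ℕ) : ZMod n) ≠ (2 : ℕ) := natCast_ne (by omega) (by omega)
    have n1 : ((1 : ℕ) : ZMod n) ≠ (2 : ℕ) := natCast_ne (by omega) (by omega)
    have n2 : ((0 : ℕ) : ZMod n) ≠ (3 : ℕ) := natCast_ne (by omega) (by omega)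
    push_cast at n0 n1 n2
    rcases C.eq_vert_of_mem_side n0 m0 m2 with ⟨h, -⟩ | ⟨h, -⟩
    · exact n1 (by rw [h, zero_add])
    · exact n2 (by rw [h]; norm_num)
  let a' := a + 1
  let b : ℕ → ℕ := fun l => if l < n then (g (a' + l) - g a').val else m
  have hb : ∀ l < n, b l = (g (a' + l) - g a').val := fun l hl => if_pos hl
  have hbn : b n = m := if_neg (lt_irrefl n)
  have hb0 : b 0 = 0 := by rw [hb 0 (by omega)]; simp
  have hbm : ∀ l < n, b l < m := fun l hl => by rw [hb l hl]; exact ZMod.val_lt _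
  have hgb : ∀ l ≤ n, g (a' + l) = g a' + b l := by
    intro l hl
    rcases hl.lt_or_eq with h | rfl
    · rw [hb l h]; simp
    · rw [hbn]; simp
  refine ⟨a', b, hb0, hbn, hbm, fun l hl => ?_, hgb⟩
  by_cases hl' : l + 1 < n
  swap
  · rw [show l + 1 = n by omega, hbn]; exact (hbm l hl).le
  rcases Nat.eq_zero_or_pos l with rfl | hl0
  · rw [hb0]; exact Nat.zero_le _
  by_contra! hlt
  have hor := C.orient_nonneg_of_mem_side hg a' hl0 (Nat.lt_succ_self l) hl'
  rw [hgb l hl.le, hgb (l + 1) hl'.le] at hor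
  rcases Nat.eq_zero_or_pos (b (l + 1)) with h0 | hpos
  · -- the vertex chosen on side `l + 1` is also on side `0`, so these sides are neighbours
    have h1 := hg (a' + (l + 1 : ℕ))
    have h2 := hgb (l + 1) hl'.le
    rw [h0, Nat.cast_zero, add_zero] at h2
    rw [h2] at h1
    have hne := add_natCast_ne_self a' (j := l + 1) (by omega) hl'
    rcases C.eq_vert_of_mem_side hne.symm (hg a') h1 with ⟨h3, -⟩ | ⟨h3, -⟩
    · exact add_natCast_ne a' (i := 1) (j := l + 1) (by omega) (by omega)
        (by rw [h3, Nat.cast_one])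
    · have h4 : a' + (l + 1 : ℕ) = a := by
        rw [← add_right_cancel_iff (a := (1 : ZMod n))]
        exact h3.symm
      rw [h4] at h2
      exact ha h2.symm
  · have := Q.orient_vert_pos (g a') hpos hlt (hbm l hl)
    rw [orient_swap] at this
    linarith

lemma pathLength_le_perim [NeZero n] (hn : 5 ≤ n) {C : ConvexPolygon n} {Q : ConvexPolygon m}
    {g : ZMod n → ZMod m} (hg : ∀ k, Q.vert (g k) ∈ C.side k) :
    pathLength (fun k => Q.vert (g k)) ≤ Q.perim := by
  obtain ⟨a, b, hb0, hbn, -, hmono, hgb⟩ := exists_lift hn hg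
  have hper : Function.Periodic (fun i : ℕ => Q.vert (g a + i)) m := fun i => by simp
  have := sum_dist_subpath_le hper hmono (by omega)
  rw [pathLength, sum_zmod_eq_sum_range _ a, Q.perim_eq_sum_range (g a)]
  refine le_of_eq_of_le (Finset.sum_congr rfl fun l hl => ?_) this
  have hl := Finset.mem_range.1 hl
  rw [← hgb l hl.le, ← hgb (l + 1) hl, Nat.cast_add, Nat.cast_one, add_assoc]

/-- If the path through vertices of `Q` chosen on the sides of `C` is as long as `Q`, then it
visits all vertices of `Q`, one after the other. -/
lemma surjective_of_perim_le [NeZero n] (hn : 5 ≤ n) {C : ConvexPolygon n} {Q : ConvexPolygon m}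
    {g : ZMod n → ZMod m} (hg : ∀ k, Q.vert (g k) ∈ C.side k)
    (hle : Q.perim ≤ pathLength (fun k => Q.vert (g k))) :
    Function.Surjective g ∧ ∀ k, g (k + 1) = g k ∨ g (k + 1) = g k + 1 := by
  have := Q.neZero
  obtain ⟨a, b, hb0, hbn, -, hmono, hgb⟩ := exists_lift hn hg
  have hper : Function.Periodic (fun i : ℕ => Q.vert (g a + i)) m := fun i => by simp
  have hstep : ∀ l < n, b (l + 1) ≤ b l + 1 := by
    refine le_succ_of_sum_dist_subpath hper hmono (by omega) (fun i => ?_) ?_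
    · have := Q.three_le
      exact dist_lt_of_orient_pos
        (Q.orient_vert_pos' (g a) (by omega) (by omega) (by omega))
    · rw [pathLength, sum_zmod_eq_sum_range _ a, Q.perim_eq_sum_range (g a)] at hle
      refine le_of_le_of_eq hle (Finset.sum_congr rfl fun l hl => ?_)
      have hl := Finset.mem_range.1 hl
      rw [← hgb l hl.le, ← hgb (l + 1) hl, Nat.cast_add, Nat.cast_one, add_assoc]
  constructor
  · have hit : ∀ l ≤ n, ∀ i ≤ b l, ∃ l' ≤ l, b l' = i := by
      intro l
      induction l with
      | zero => exact fun _ i hi => ⟨0, le_rfl, by omega⟩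
      | succ l ih =>
        intro hl i hi
        by_cases h : i ≤ b l
        · obtain ⟨l', h1, h2⟩ := ih (by omega) i h
          exact ⟨l', by omega, h2⟩
        · have := hstep l (by omega)
          exact ⟨l + 1, le_rfl, by omega⟩
    intro z
    obtain ⟨l, hl, hbl⟩ := hit n le_rfl (z - g a).val (by rw [hbn]; exact (ZMod.val_lt _).le)
    exact ⟨a + l, by rw [hgb l hl, hbl]; simp⟩
  · intro k
    have hl := ZMod.val_lt (k - a)
    have hk : k = a + ((k - a).val : ℕ) := by simp
    have hk1 : k + 1 = a + ((k - a).val + 1 : ℕ) := by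
      rw [Nat.cast_add, Nat.cast_one, ← add_assoc, ← hk]
    rw [hk1, hgb _ (by omega), show g k = g a + b (k - a).val by
      conv_lhs => rw [hk, hgb _ hl.le]]
    have h1 := hmono _ hl
    have h2 := hstep _ hl
    rcases h1.eq_or_lt with h | h
    · exact Or.inl (by rw [h])
    · exact Or.inr (by rw [show b ((k - a).val + 1) = b (k - a).val + 1 by omega]; push_cast; ring)

/-- `q` chooses a point on each side of `C`, and no other choice gives a shorter closed path. -/
structure IsShortestPath [NeZero n] (C : ConvexPolygon n) (q : ZMod n → Plane) : Prop where
  mem_side : ∀ k, q k ∈ C.side k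
  le : ∀ q' : ZMod n → Plane, (∀ k, q' k ∈ C.side k) → pathLength q ≤ pathLength q'

lemma IsMinPerim.perim_le_pathLength [NeZero n] (hn : 5 ≤ n) {C : ConvexPolygon n}
    {Q : ConvexPolygon m} (hQ : Q.IsMinPerim C) {q : ZMod n → Plane}
    (hq : ∀ k, q k ∈ C.side k) : Q.perim ≤ pathLength q := by
  obtain ⟨T, hT⟩ := C.exists_isMinimalCover hq
  obtain ⟨m', Q', hQ', -, hle⟩ := hT.exists_polygon hq hn
  exact (hQ.2 m' Q' hQ').trans hle

lemma IsMinPerim.isShortestPath [NeZero n] (hn : 5 ≤ n) {C : ConvexPolygon n}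
    {Q : ConvexPolygon m} (hQ : Q.IsMinPerim C) {g : ZMod n → ZMod m}
    (hg : ∀ k, Q.vert (g k) ∈ C.side k) : C.IsShortestPath (fun k => Q.vert (g k)) :=
  ⟨hg, fun _ hq' => (pathLength_le_perim hn hg).trans (hQ.perim_le_pathLength hn hq')⟩

lemma IsMinPerim.surjective [NeZero n] (hn : 5 ≤ n) {C : ConvexPolygon n}
    {Q : ConvexPolygon m} (hQ : Q.IsMinPerim C) {g : ZMod n → ZMod m}
    (hg : ∀ k, Q.vert (g k) ∈ C.side k) :
    Function.Surjective g ∧ ∀ k, g (k + 1) = g k ∨ g (k + 1) = g k + 1 :=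
  surjective_of_perim_le hn hg (hQ.perim_le_pathLength hn hg)

/-- Points on the sides that are no vertices of `C` cannot be omitted from a path along the
sides, as each of them lies on one side only. -/
lemma isMinimalCover_univ [NeZero n] {C : ConvexPolygon n} {q : ZMod n → Plane}
    (hq : ∀ k, q k ∈ C.side k) (hv : ∀ k j, q k ≠ C.vert j) :
    C.IsMinimalCover q Finset.univ where
  cover i := ⟨i, Finset.mem_univ i, hq i⟩
  needed k _ := by
    refine ⟨k, hq k, fun l _ hl => ?_⟩
    by_contra hne
    rcases C.eq_vert_of_mem_side hne (hq l) hl with ⟨-, h⟩ | ⟨-, h⟩ <;> exact hv _ _ h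

/-- A shortest path that avoids the vertices of `C` bounds a minimum perimeter polygon. -/
lemma IsShortestPath.exists_polygon [NeZero n] (hn : 5 ≤ n) {C : ConvexPolygon n}
    {q : ZMod n → Plane} (h : C.IsShortestPath q) (hv : ∀ k j, q k ≠ C.vert j) :
    ∃ (m : ℕ) (Q : ConvexPolygon m), Q.IsMinPerim C ∧ Set.range Q.vert = Set.range q := by
  obtain ⟨m, Q, hQ, hr, hle⟩ := (isMinimalCover_univ h.mem_side hv).exists_polygon h.mem_side hn
  refine ⟨m, Q, ⟨hQ, fun m' Q' hQ' => ?_⟩, by simpa using hr⟩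
  choose g hg using hQ'
  exact hle.trans ((h.le _ hg).trans (pathLength_le_perim hn hg))

/-! ### Comparing two shortest paths -/

/-- The direction vector of the side from `vert k` to `vert (k + 1)`. -/
def sideVec (P : ConvexPolygon m) (k : ZMod m) : Plane := P.vert (k + 1) - P.vert k

lemma planeDet_sideVec_pos (P : ConvexPolygon m) (k : ZMod m) :
    0 < planeDet (P.sideVec k) (P.sideVec (k + 1)) := by
  have h3 := P.three_le
  have := P.orient_vert_pos k (j := 1) (k := 2) (by omega) (by omega) (by omega)
  have e : k + ((2 : ℕ) : ZMod m) = k + 1 + 1 := by push_cast; ring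
  rw [e, Nat.cast_one, orient_eq] at this
  simp only [planeDet, sideVec, PiLp.sub_apply]
  linarith

lemma mem_side_iff (P : ConvexPolygon m) {k : ZMod m} {x : Plane} :
    x ∈ P.side k ↔ ∃ t : ℝ, 0 ≤ t ∧ t ≤ 1 ∧ x = P.vert k + t • P.sideVec k :=
  mem_segment_iff_add_smul

lemma sideVec_ne_zero (P : ConvexPolygon m) (k : ZMod m) : P.sideVec k ≠ 0 := by
  intro h
  have := P.planeDet_sideVec_pos k
  rw [h] at this
  simp [planeDet] at this

lemma add_smul_sideVec_ne_vert (P : ConvexPolygon m) {k : ZMod m} {t : ℝ} (h0 : 0 < t)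
    (h1 : t < 1) (j : ZMod m) : P.vert k + t • P.sideVec k ≠ P.vert j := by
  intro h
  have hs : P.vert j ∈ P.side k := P.mem_side_iff.2 ⟨t, h0.le, h1.le, h.symm⟩
  rcases P.vert_mem_side_iff.1 hs with rfl | rfl
  · simp [P.sideVec_ne_zero, h0.ne'] at h
  · have h2 : (t - 1) • P.sideVec k = 0 := by
      rw [sub_smul, one_smul, sub_eq_zero]
      nth_rewrite 2 [sideVec]
      rw [← h]; abel
    rcases smul_eq_zero.1 h2 with h3 | h3
    · linarith
    · exact P.sideVec_ne_zero k h3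

/-- The step between points on neighbouring sides, in terms of the side vectors. -/
lemma path_step_eq (C : ConvexPolygon n) {q : ZMod n → Plane} {t : ZMod n → ℝ}
    (hq : ∀ k, q k = C.vert k + t k • C.sideVec k) (k : ZMod n) :
    q (k + 1) - q k = (1 - t k) • C.sideVec k + t (k + 1) • C.sideVec (k + 1) := by
  have : C.vert (k + 1) = C.vert k + C.sideVec k := by simp [sideVec]
  rw [hq, hq, this, sub_smul, one_smul]
  abel

/-- The midpoints of two shortest paths form a path which is no longer, so the triangle
inequality is an equality for each pair of corresponding steps. -/
lemma IsShortestPath.sameRay [NeZero n] {C : ConvexPolygon n} {q₁ q₂ : ZMod n → Plane}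
    (h₁ : C.IsShortestPath q₁) (h₂ : C.IsShortestPath q₂) (k : ZMod n) :
    SameRay ℝ (q₁ (k + 1) - q₁ k) (q₂ (k + 1) - q₂ k) := by
  let M : ZMod n → Plane := fun k => (1 / 2 : ℝ) • q₁ k + (1 / 2 : ℝ) • q₂ k
  have hM : ∀ k, M k ∈ C.side k := fun k =>
    convex_segment (𝕜 := ℝ) _ _ (h₁.mem_side k) (h₂.mem_side k) (by norm_num) (by norm_num)
      (by norm_num)
  have e1 := h₁.le M hM
  have e2 := h₂.le M hM
  have e3 : ∑ k, (‖q₁ (k + 1) - q₁ k‖ + ‖q₂ (k + 1) - q₂ k‖ -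
      ‖(q₁ (k + 1) - q₁ k) + (q₂ (k + 1) - q₂ k)‖) ≤ 0 := by
    have hd : ∀ k, dist (M k) (M (k + 1)) =
        1 / 2 * ‖(q₁ (k + 1) - q₁ k) + (q₂ (k + 1) - q₂ k)‖ := by
      intro k
      rw [dist_comm, dist_eq_norm, ← Real.norm_of_nonneg (by norm_num : (0 : ℝ) ≤ 1 / 2),
        ← norm_smul]
      congr 1
      simp only [M]
      module
    have hM' : pathLength M =
        1 / 2 * ∑ k, ‖(q₁ (k + 1) - q₁ k) + (q₂ (k + 1) - q₂ k)‖ := by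
      rw [pathLength, Finset.mul_sum]
      exact Finset.sum_congr rfl fun k _ => hd k
    have hp : ∀ q : ZMod n → Plane, pathLength q = ∑ k, ‖q (k + 1) - q k‖ := fun q =>
      Finset.sum_congr rfl fun k _ => by rw [dist_comm, dist_eq_norm]
    rw [hM', hp] at e1 e2
    rw [Finset.sum_sub_distrib, Finset.sum_add_distrib]
    linarith
  have hnn : ∀ k ∈ Finset.univ, 0 ≤ ‖q₁ (k + 1) - q₁ k‖ + ‖q₂ (k + 1) - q₂ k‖ -
      ‖(q₁ (k + 1) - q₁ k) + (q₂ (k + 1) - q₂ k)‖ := fun k _ =>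
    sub_nonneg.2 (norm_add_le _ _)
  have h0 := (Finset.sum_eq_zero_iff_of_nonneg hnn).1 (le_antisymm e3 (Finset.sum_nonneg hnn)) k
    (Finset.mem_univ k)
  exact sameRay_iff_norm_add.2 (by linarith)

lemma planeDet_eq_zero_of_sameRay {u w : Plane} (h : SameRay ℝ u w) : planeDet u w = 0 := by
  rcases h with rfl | rfl | ⟨a, b, ha, hb, h⟩
  · simp [planeDet]
  · simp [planeDet]
  · have h0 := congrArg (fun v : Plane => v 0) h
    have h1 := congrArg (fun v : Plane => v 1) h
    simp only [PiLp.smul_apply, smul_eq_mul] at h0 h1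
    refine (mul_eq_zero.1 (?_ : a * planeDet u w = 0)).resolve_left ha.ne'
    rw [planeDet]
    linear_combination w 1 * h0 - w 0 * h1

/-- The displacement `t₂ k - t₁ k` between two shortest paths on one side determines that on the
next side, because corresponding steps are parallel. -/
lemma IsShortestPath.displacement [NeZero n] {C : ConvexPolygon n} {q₁ q₂ : ZMod n → Plane}
    (h₁ : C.IsShortestPath q₁) (h₂ : C.IsShortestPath q₂) {t₁ t₂ : ZMod n → ℝ}
    (e₁ : ∀ k, q₁ k = C.vert k + t₁ k • C.sideVec k)
    (e₂ : ∀ k, q₂ k = C.vert k + t₂ k • C.sideVec k) (k : ZMod n) :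
    (1 - t₁ k) * (t₂ (k + 1) - t₁ (k + 1)) + t₁ (k + 1) * (t₂ k - t₁ k) = 0 := by
  have h := planeDet_eq_zero_of_sameRay (h₁.sameRay h₂ k)
  rw [C.path_step_eq e₁, C.path_step_eq e₂] at h
  refine (mul_eq_zero.1 (?_ : _ * planeDet (C.sideVec k) (C.sideVec (k + 1)) = 0)).resolve_right
    (C.planeDet_sideVec_pos k).ne'
  rw [← h]
  simp only [planeDet, PiLp.add_apply, PiLp.smul_apply, smul_eq_mul]
  ring

/-- Two shortest paths which agree on one side agree everywhere, provided that whenever the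
first passes through the common vertex of two sides by way of the first side, both make the same
choice on the second side. -/
lemma IsShortestPath.eq_of_eq [NeZero n] {C : ConvexPolygon n} {q₁ q₂ : ZMod n → Plane}
    (h₁ : C.IsShortestPath q₁) (h₂ : C.IsShortestPath q₂)
    (hv : ∀ k, q₁ k = C.vert (k + 1) → q₁ (k + 1) = q₂ (k + 1)) {a : ZMod n}
    (ha : q₁ a = q₂ a) : q₁ = q₂ := by
  choose t₁ _ _ e₁ using fun k => C.mem_side_iff.1 (h₁.mem_side k)
  choose t₂ _ _ e₂ using fun k => C.mem_side_iff.1 (h₂.mem_side k)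
  have hstep : ∀ k, q₁ k = q₂ k → q₁ (k + 1) = q₂ (k + 1) := by
    intro k hk
    by_cases h1 : t₁ k = 1
    · exact hv k (by rw [e₁, h1]; simp [sideVec])
    · have ht : t₁ k = t₂ k := by
        rw [e₁, e₂] at hk
        exact smul_left_injective ℝ (C.sideVec_ne_zero k) (add_left_cancel hk)
      have hd := h₁.displacement h₂ e₁ e₂ k
      rw [← ht, sub_self, mul_zero, add_zero] at hd
      have h2 := (mul_eq_zero.1 hd).resolve_left (sub_ne_zero.2 (Ne.symm h1))
      rw [e₁, e₂, sub_eq_zero.1 h2]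
  have hall : ∀ l : ℕ, q₁ (a + l) = q₂ (a + l) := by
    intro l
    induction l with
    | zero => simpa using ha
    | succ l ih => simpa [add_assoc] using hstep _ ih
  funext k
  simpa using hall (k - a).val

/-- Displacements between shortest paths that avoid the vertices alternate in sign, which is
impossible around an odd cycle unless they vanish. -/
lemma IsShortestPath.eq_of_odd [NeZero n] (hn : Odd n) {C : ConvexPolygon n}
    {q₁ q₂ : ZMod n → Plane} (h₁ : C.IsShortestPath q₁) (h₂ : C.IsShortestPath q₂)
    (hv : ∀ k j, q₁ k ≠ C.vert j) : q₁ = q₂ := by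
  choose t₁ hn₁ hl₁ e₁ using fun k => C.mem_side_iff.1 (h₁.mem_side k)
  choose t₂ _ _ e₂ using fun k => C.mem_side_iff.1 (h₂.mem_side k)
  have hp : ∀ k, 0 < t₁ k := fun k => (hn₁ k).lt_of_ne' fun h =>
    hv k k (by rw [e₁, h]; simp)
  have hl : ∀ k, t₁ k < 1 := fun k => (hl₁ k).lt_of_ne fun h =>
    hv k (k + 1) (by rw [e₁, h]; simp [sideVec])
  let x : ZMod n → ℝ := fun k => t₂ k - t₁ k
  have hx : ∀ k, (1 - t₁ k) * x (k + 1) = -(t₁ (k + 1) * x k) := fun k =>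
    eq_neg_of_add_eq_zero_left (h₁.displacement h₂ e₁ e₂ k)
  suffices hx0 : x 0 = 0 from
    h₁.eq_of_eq h₂ (fun k h => absurd h (hv _ _)) (a := 0)
      (by rw [e₁, e₂, sub_eq_zero.1 hx0])
  by_contra hne
  have halt : ∀ l : ℕ, 0 < (-1) ^ l * x l * x 0 := by
    intro l
    induction l with
    | zero => simpa using mul_self_pos.2 hne
    | succ l ih =>
      have h1 : 0 < 1 - t₁ l := sub_pos.2 (hl _)
      refine pos_of_mul_pos_right (a := 1 - t₁ l) ?_ h1.le
      have : (1 - t₁ l) * ((-1) ^ (l + 1) * x (l + 1 : ℕ) * x 0) =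
          t₁ (l + 1) * ((-1) ^ l * x l * x 0) := by
        push_cast
        linear_combination (-1) ^ (l + 1) * x 0 * hx l
      rw [this]
      exact mul_pos (hp _) ih
  have := halt n
  rw [hn.neg_one_pow, ZMod.natCast_self] at this
  nlinarith [mul_self_nonneg (x 0)]

/-- The vertices of an inscribed polygon can be chosen on the sides of `C` so that used vertices
of `C` are preferred. -/
lemma IsInscribed.exists_choice {C : ConvexPolygon n} {Q : ConvexPolygon m}
    (hQ : Q.IsInscribed C) : ∃ g : ZMod n → ZMod m, (∀ k, Q.vert (g k) ∈ C.side k) ∧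
      ∀ k, C.vert k ∈ Set.range Q.vert → Q.vert (g k) = C.vert k := by
  have : ∀ k, ∃ j, Q.vert j ∈ C.side k ∧ (C.vert k ∈ Set.range Q.vert → Q.vert j = C.vert k) := by
    intro k
    by_cases h : C.vert k ∈ Set.range Q.vert
    · obtain ⟨j, hj⟩ := h
      exact ⟨j, hj ▸ C.left_mem_side k, fun _ => hj⟩
    · obtain ⟨j, hj⟩ := hQ k
      exact ⟨j, hj, fun h' => absurd h' h⟩
  choose g h1 h2 using this
  exact ⟨g, h1, h2⟩

lemma assocSeq_eq_U_iff {C : ConvexPolygon n} {Q : ConvexPolygon m} {k : ZMod n} :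
    C.assocSeq Q k = UseLetter.U ↔ C.vert k ∈ Set.range Q.vert := by
  unfold assocSeq; split_ifs with h <;> simp [h]

lemma assocSeq_eq_N_iff {C : ConvexPolygon n} {Q : ConvexPolygon m} :
    (C.assocSeq Q = fun _ => UseLetter.N) ↔ ∀ k j, Q.vert j ≠ C.vert k := by
  simp [funext_iff, assocSeq]

/-- If `n` is odd or a vertex of `C` is used, then the paths through the vertices of two minimum
perimeter polygons agree somewhere and hence everywhere. -/
lemma minPerimWithSeq_subsingleton (hn : 5 ≤ n) (C : ConvexPolygon n) (s : ZMod n → UseLetter)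
    (h : Odd n ∨ s ≠ fun _ => UseLetter.N) : (C.minPerimWithSeq s).Subsingleton := by
  have := C.neZero
  rintro _ ⟨m₁, Q₁, hQ₁, rfl, rfl⟩ _ ⟨m₂, Q₂, hQ₂, hs, rfl⟩
  obtain ⟨g₁, hg₁, hu₁⟩ := hQ₁.1.exists_choice
  obtain ⟨g₂, hg₂, hu₂⟩ := hQ₂.1.exists_choice
  have p₁ := hQ₁.isShortestPath hn hg₁
  have p₂ := hQ₂.isShortestPath hn hg₂
  have hU : ∀ k, C.vert k ∈ Set.range Q₁.vert → Q₁.vert (g₁ k) = Q₂.vert (g₂ k) := by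
    intro k hk
    rw [hu₁ k hk, hu₂ k (assocSeq_eq_U_iff.1 (by rw [hs]; exact assocSeq_eq_U_iff.2 hk))]
  have heq : (fun k => Q₁.vert (g₁ k)) = fun k => Q₂.vert (g₂ k) := by
    by_cases hN : C.assocSeq Q₁ = fun _ => UseLetter.N
    · exact p₁.eq_of_odd (h.resolve_right fun h' => h' hN) p₂
        fun k j => assocSeq_eq_N_iff.1 hN j (g₁ k)
    · rw [assocSeq_eq_N_iff] at hN
      push Not at hN
      obtain ⟨k, j, hj⟩ := hN
      exact p₁.eq_of_eq p₂ (fun k hk => hU _ ⟨_, hk⟩) (hU k ⟨j, hj⟩)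
  have hr : Set.range Q₁.vert = Set.range Q₂.vert := by
    rw [← (hQ₁.surjective hn hg₁).1.range_comp, ← (hQ₂.surjective hn hg₂).1.range_comp]
    exact congrArg Set.range heq
  rw [region, region, hr]

/-- Minimum perimeter polygons that use no vertex of `C` have one vertex on each side of `C`, and
corresponding sides are parallel. -/
lemma IsMinPerim.exists_sideMatching (hn : 5 ≤ n) {C : ConvexPolygon n} {m₁ m₂ : ℕ}
    {Q₁ : ConvexPolygon m₁} {Q₂ : ConvexPolygon m₂} (hQ₁ : Q₁.IsMinPerim C)
    (hQ₂ : Q₂.IsMinPerim C) (hN₁ : ∀ k j, Q₁.vert j ≠ C.vert k)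
    (hN₂ : ∀ k j, Q₂.vert j ≠ C.vert k) :
    ∃ (e₁ : ZMod n ≃ ZMod m₁) (e₂ : ZMod n ≃ ZMod m₂),
      C.IsSideMatching Q₁ e₁ ∧ C.IsSideMatching Q₂ e₂ ∧
      ∀ k : ZMod n, Q₁.sideLine (e₁ k) ∥ Q₂.sideLine (e₂ k) := by
  have := C.neZero
  have key : ∀ {m : ℕ} {Q : ConvexPolygon m}, Q.IsMinPerim C → (∀ k j, Q.vert j ≠ C.vert k) →
      ∃ e : ZMod n ≃ ZMod m, C.IsSideMatching Q e := by
    intro m Q hQ hN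
    choose g hg using hQ.1
    have hinj : Function.Injective g := by
      intro k l hkl
      by_contra hne
      rcases C.eq_vert_of_mem_side hne (hg k) (hkl ▸ hg l) with ⟨-, h⟩ | ⟨-, h⟩
      · exact hN _ _ h
      · exact hN _ _ h
    obtain ⟨hs, h1⟩ := hQ.surjective hn hg
    refine ⟨Equiv.ofBijective g ⟨hinj, hs⟩, fun k => ⟨(h1 k).resolve_left fun h => ?_, hg k⟩⟩
    have := add_natCast_ne_self k (j := 1) (by omega) (by omega)
    exact this (by rw [Nat.cast_one]; exact hinj h)
  obtain ⟨e₁, h₁⟩ := key hQ₁ hN₁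
  obtain ⟨e₂, h₂⟩ := key hQ₂ hN₂
  refine ⟨e₁, e₂, h₁, h₂, fun k => ?_⟩
  have hray := (hQ₁.isShortestPath hn fun k => (h₁ k).2).sameRay
    (hQ₂.isShortestPath hn fun k => (h₂ k).2) k
  simp only [(h₁ k).1, (h₂ k).1] at hray
  have hne : ∀ {m : ℕ} (Q : ConvexPolygon m) (j : ZMod m), Q.vert (j + 1) - Q.vert j ≠ 0 :=
    fun Q j => Q.sideVec_ne_zero j
  obtain ⟨r, s, hr, hs, hrs⟩ := hray.exists_pos (hne _ _) (hne _ _)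
  rw [sideLine, sideLine, AffineSubspace.affineSpan_pair_parallel_iff_vectorSpan_eq, vectorSpan_pair_rev,
    vectorSpan_pair_rev, vsub_eq_sub, vsub_eq_sub,
    ← Submodule.span_singleton_smul_eq (IsUnit.mk0 r hr.ne') (Q₁.vert _ - _), hrs,
    Submodule.span_singleton_smul_eq (IsUnit.mk0 s hs.ne')]

/-! ### The family of shortest paths around an even polygon -/

lemma inner_plane (u w : Plane) : inner ℝ u w = u 0 * w 0 + u 1 * w 1 := by
  simp [PiLp.inner_apply, Fin.sum_univ_two, mul_comm]

lemma norm_sq_plane (u : Plane) : ‖u‖ ^ 2 = u 0 ^ 2 + u 1 ^ 2 := by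
  rw [← real_inner_self_eq_norm_sq, inner_plane]; ring

lemma exists_smul_of_planeDet_eq_zero {u w : Plane} (hu : u ≠ 0) (h : planeDet u w = 0) :
    ∃ μ : ℝ, w = μ • u := by
  have hN : u 0 ^ 2 + u 1 ^ 2 ≠ 0 := by
    rw [← norm_sq_plane]; exact pow_ne_zero _ (norm_ne_zero_iff.2 hu)
  unfold planeDet at h
  refine ⟨(u 0 * w 0 + u 1 * w 1) / (u 0 ^ 2 + u 1 ^ 2), ?_⟩
  ext i
  fin_cases i
  · simp only [PiLp.smul_apply, smul_eq_mul, Fin.zero_eta]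
    field_simp
    linear_combination -u 1 * h
  · simp only [PiLp.smul_apply, smul_eq_mul, Fin.mk_one]
    field_simp
    linear_combination u 0 * h

lemma hasDerivAt_norm_add_smul {d : Plane} (hd : d ≠ 0) (w : Plane) :
    HasDerivAt (fun c : ℝ => ‖d + c • w‖) (inner ℝ d w / ‖d‖) 0 := by
  have h1 : HasDerivAt (fun c : ℝ => d + c • w) w 0 := by
    simpa using ((hasDerivAt_id (0 : ℝ)).smul_const w).const_add d
  have h2 := h1.norm_sq.sqrt (by simpa using hd)
  simp only [zero_smul, add_zero, Real.sqrt_sq (norm_nonneg _)] at h2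
  convert h2 using 1
  rw [mul_div_mul_left _ _ two_ne_zero]

lemma path_add_step_eq (C : ConvexPolygon n) {q : ZMod n → Plane} (v : ZMod n → ℝ) (c : ℝ)
    (k : ZMod n) : (q (k + 1) + (c * v (k + 1)) • C.sideVec (k + 1)) -
      (q k + (c * v k) • C.sideVec k) = (q (k + 1) - q k) +
        c • (v (k + 1) • C.sideVec (k + 1) - v k • C.sideVec k) := by
  module

lemma planeDet_step_eq (C : ConvexPolygon n) {q : ZMod n → Plane} {t : ZMod n → ℝ}
    (hq : ∀ k, q k = C.vert k + t k • C.sideVec k) (k : ZMod n) :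
    planeDet (q (k + 1) - q k) (C.sideVec (k + 1)) =
      (1 - t k) * planeDet (C.sideVec k) (C.sideVec (k + 1)) := by
  rw [C.path_step_eq hq]
  simp only [planeDet, PiLp.add_apply, PiLp.smul_apply, smul_eq_mul]
  ring

/-- The points `C.vert k + (t k + c * v k) • C.sideVec k` still lie in the open sides of `C` for
small `c`. -/
lemma eventually_mem_Ioo [NeZero n] {t : ZMod n → ℝ} (h0 : ∀ k, 0 < t k) (h1 : ∀ k, t k < 1)
    (v : ZMod n → ℝ) : ∀ᶠ c : ℝ in nhds 0, ∀ k, 0 < t k + c * v k ∧ t k + c * v k < 1 := by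
  refine Filter.eventually_all.2 fun k => ?_
  have hc : Filter.Tendsto (fun c : ℝ => t k + c * v k) (nhds 0) (nhds (t k)) := by
    have : Continuous fun c : ℝ => t k + c * v k := by fun_prop
    simpa using this.tendsto 0
  exact (hc.eventually_const_lt (h0 k)).and (hc.eventually_lt_const (h1 k))

/-- The first variation of the length vanishes at a shortest path that avoids the vertices. -/
lemma IsShortestPath.first_variation [NeZero n] {C : ConvexPolygon n} {q : ZMod n → Plane}
    (h : C.IsShortestPath q) {t : ZMod n → ℝ} (h0 : ∀ k, 0 < t k) (h1 : ∀ k, t k < 1)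
    (e : ∀ k, q k = C.vert k + t k • C.sideVec k) (hd : ∀ k, q (k + 1) - q k ≠ 0)
    (v : ZMod n → ℝ) :
    ∑ k, inner ℝ (q (k + 1) - q k) (v (k + 1) • C.sideVec (k + 1) - v k • C.sideVec k) /
      ‖q (k + 1) - q k‖ = 0 := by
  let F : ℝ → ℝ := fun c => ∑ k, ‖(q (k + 1) - q k) +
    c • (v (k + 1) • C.sideVec (k + 1) - v k • C.sideVec k)‖
  have hF : HasDerivAt F (∑ k, inner ℝ (q (k + 1) - q k)
      (v (k + 1) • C.sideVec (k + 1) - v k • C.sideVec k) / ‖q (k + 1) - q k‖) 0 :=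
    HasDerivAt.fun_sum fun k _ => hasDerivAt_norm_add_smul (hd k) _
  have hFl : ∀ c, F c = pathLength fun k => q k + (c * v k) • C.sideVec k := fun c =>
    Finset.sum_congr rfl fun k _ => by rw [dist_comm, dist_eq_norm, path_add_step_eq]
  have hmin : IsLocalMin F 0 := by
    filter_upwards [eventually_mem_Ioo h0 h1 v] with c hc
    have : F 0 = pathLength q := by rw [hFl]; simp
    rw [this, hFl]
    refine h.le _ fun k => C.mem_side_iff.2 ⟨t k + c * v k, (hc k).1.le, (hc k).2.le, ?_⟩
    rw [e k, add_smul, add_assoc]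
  exact hmin.hasDerivAt_eq_zero hF

/-- Consecutive steps of a shortest path make equal angles with the side they meet. -/
lemma IsShortestPath.reflection [NeZero n] {C : ConvexPolygon n} {q : ZMod n → Plane}
    (h : C.IsShortestPath q) {t : ZMod n → ℝ} (h0 : ∀ k, 0 < t k) (h1 : ∀ k, t k < 1)
    (e : ∀ k, q k = C.vert k + t k • C.sideVec k) (hd : ∀ k, q (k + 1) - q k ≠ 0)
    (j : ZMod n) :
    inner ℝ (q (j + 1) - q j) (C.sideVec (j + 1)) / ‖q (j + 1) - q j‖ =
      inner ℝ (q (j + 1 + 1) - q (j + 1)) (C.sideVec (j + 1)) / ‖q (j + 1 + 1) - q (j + 1)‖ := by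
  have hv := h.first_variation h0 h1 e hd (Pi.single (j + 1) 1)
  simp only [inner_sub_right, inner_smul_right, sub_div, Finset.sum_sub_distrib,
    mul_div_assoc] at hv
  rw [Finset.sum_eq_single j (fun k _ hk => by
      rw [Pi.single_eq_of_ne (fun h => hk (add_right_cancel h)), zero_mul])
      (fun h => absurd (Finset.mem_univ j) h),
    Finset.sum_eq_single (j + 1) (fun k _ hk => by rw [Pi.single_eq_of_ne hk, zero_mul])
      (fun h => absurd (Finset.mem_univ _) h)] at hv
  simpa [sub_eq_zero] using hv

/-- Going once around an even cycle, signs can be chosen alternately. -/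
lemma exists_alternating [NeZero n] (hn : Even n) :
    ∃ ε : ZMod n → ℝ, (∀ k, ε (k + 1) = -ε k) ∧ ∀ k, ε k ≠ 0 := by
  refine ⟨fun k => (-1) ^ k.val, fun k => ?_, fun k => pow_ne_zero _ (by norm_num)⟩
  have hk := ZMod.val_lt k
  by_cases h : k.val + 1 < n
  · change (-1 : ℝ) ^ (k + 1).val = _
    rw [val_add_one_of_lt h, pow_succ]; ring
  · have h1 : k.val + 1 = n := by omega
    have h2 : k + 1 = 0 := by
      have : k + 1 = ((k.val + 1 : ℕ) : ZMod n) := by simp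
      rw [this, h1, ZMod.natCast_self]
    have h3 : Odd k.val := by
      rw [← h1] at hn
      exact Nat.not_even_iff_odd.1 fun h => (Nat.even_add_one.1 hn) h
    change (-1 : ℝ) ^ (k + 1).val = -(-1) ^ k.val
    rw [h2, ZMod.val_zero, h3.neg_one_pow]; norm_num

/-- A shortest path around an even polygon that avoids the vertices can be moved so that its
steps keep their directions. By the law of reflection the displacement times the sine of the
angle of reflection just changes sign from one side to the next, which closes up for even `n`. -/
lemma IsShortestPath.exists_parallel_variation [NeZero n] (hn : Even n) {C : ConvexPolygon n}
    {q : ZMod n → Plane} (h : C.IsShortestPath q) {t : ZMod n → ℝ} (h0 : ∀ k, 0 < t k)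
    (h1 : ∀ k, t k < 1) (e : ∀ k, q k = C.vert k + t k • C.sideVec k)
    (hd : ∀ k, q (k + 1) - q k ≠ 0) :
    ∃ v μ : ZMod n → ℝ, (∀ k, v k ≠ 0) ∧ ∀ k,
      v (k + 1) • C.sideVec (k + 1) - v k • C.sideVec k = μ k • (q (k + 1) - q k) := by
  obtain ⟨ε, hε, hε0⟩ := exists_alternating hn
  -- the signed sines (up to the length of the side vectors) of the angles at the sides
  let A : ZMod n → ℝ := fun k => planeDet (q (k + 1) - q k) (C.sideVec (k + 1)) / ‖q (k + 1) - q k‖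
  let B : ZMod n → ℝ := fun k => planeDet (q (k + 1) - q k) (C.sideVec k) / ‖q (k + 1) - q k‖
  have hnorm : ∀ k, 0 < ‖q (k + 1) - q k‖ := fun k => norm_pos_iff.2 (hd k)
  have hA : ∀ k, 0 < A k := by
    intro k
    refine div_pos ?_ (hnorm k)
    rw [C.planeDet_step_eq e]
    exact mul_pos (sub_pos.2 (h1 k)) (C.planeDet_sideVec_pos k)
  have hB : ∀ k, B k < 0 := by
    intro k
    refine div_neg_of_neg_of_pos ?_ (hnorm k)
    have : planeDet (q (k + 1) - q k) (C.sideVec k) =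
        -(t (k + 1) * planeDet (C.sideVec k) (C.sideVec (k + 1))) := by
      rw [C.path_step_eq e]
      simp only [planeDet, PiLp.add_apply, PiLp.smul_apply, smul_eq_mul]; ring
    rw [this]
    exact neg_neg_of_pos (mul_pos (h0 _) (C.planeDet_sideVec_pos k))
  have hAB : ∀ k, A k = -B (k + 1) := by
    intro k
    have hlag : ∀ d u : Plane, d ≠ 0 →
        (planeDet d u / ‖d‖) ^ 2 = ‖u‖ ^ 2 - (inner ℝ d u / ‖d‖) ^ 2 := by
      intro d u hd
      have hN : d 0 ^ 2 + d 1 ^ 2 ≠ 0 := by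
        rw [← norm_sq_plane]; exact pow_ne_zero _ (norm_ne_zero_iff.2 hd)
      rw [div_pow, div_pow, norm_sq_plane, norm_sq_plane, inner_plane, planeDet]
      field_simp
      ring
    have hsq : A k ^ 2 = B (k + 1) ^ 2 := by
      simp only [A, B]
      rw [hlag _ _ (hd k), hlag _ _ (hd (k + 1)), h.reflection h0 h1 e hd k]
    rcases sq_eq_sq_iff_eq_or_eq_neg.1 hsq with h2 | h2
    · linarith [hA k, hB (k + 1)]
    · exact h2
  let v : ZMod n → ℝ := fun k => ε k / B k
  have hdet : ∀ k, planeDet (q (k + 1) - q k)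
      (v (k + 1) • C.sideVec (k + 1) - v k • C.sideVec k) = 0 := by
    intro k
    have hA' : planeDet (q (k + 1) - q k) (C.sideVec (k + 1)) = ‖q (k + 1) - q k‖ * A k :=
      (mul_div_cancel₀ _ (hnorm k).ne').symm
    have hB' : planeDet (q (k + 1) - q k) (C.sideVec k) = ‖q (k + 1) - q k‖ * B k :=
      (mul_div_cancel₀ _ (hnorm k).ne').symm
    have hlin : ∀ (d u w : Plane) (a b : ℝ), planeDet d (a • u - b • w) =
        a * planeDet d u - b * planeDet d w := by
      intro d u w a b
      simp only [planeDet, PiLp.sub_apply, PiLp.smul_apply, smul_eq_mul]; ring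
    have hv : ∀ k, v k * B k = ε k := fun k => div_mul_cancel₀ _ (hB k).ne
    rw [hlin, hA', hB', hAB]
    linear_combination -‖q (k + 1) - q k‖ * (hv (k + 1) + hv k + hε k)
  choose μ hμ using fun k => exists_smul_of_planeDet_eq_zero (hd k) (hdet k)
  exact ⟨v, μ, fun k => div_ne_zero (hε0 k) (hB k).ne, hμ⟩

/-- Around an even polygon, a shortest path that avoids the vertices moves in a one-parameter
family of such paths. -/
lemma IsShortestPath.exists_family [NeZero n] (hn : Even n) {C : ConvexPolygon n}
    {q : ZMod n → Plane} (h : C.IsShortestPath q) (hv : ∀ k j, q k ≠ C.vert j) :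
    ∃ v : ZMod n → ℝ, (∀ k, v k ≠ 0) ∧ ∃ δ > 0, ∀ c ∈ Set.Ioo (-δ) δ,
      C.IsShortestPath (fun k => q k + (c * v k) • C.sideVec k) ∧
      ∀ k j, q k + (c * v k) • C.sideVec k ≠ C.vert j := by
  choose t hn₁ hl₁ e using fun k => C.mem_side_iff.1 (h.mem_side k)
  have h0 : ∀ k, 0 < t k := fun k => (hn₁ k).lt_of_ne' fun h => hv k k (by rw [e, h]; simp)
  have h1 : ∀ k, t k < 1 := fun k => (hl₁ k).lt_of_ne fun h =>
    hv k (k + 1) (by rw [e, h]; simp [sideVec])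
  have hd : ∀ k, q (k + 1) - q k ≠ 0 := by
    intro k hk
    have := C.planeDet_sideVec_pos k
    have h3 := mul_pos (sub_pos.2 (h1 k)) this
    rw [← C.planeDet_step_eq e, hk] at h3
    simp [planeDet] at h3
  obtain ⟨v, μ, hv0, hμ⟩ := h.exists_parallel_variation hn h0 h1 e hd
  have hsum : ∑ k, μ k * ‖q (k + 1) - q k‖ = 0 := by
    rw [← h.first_variation h0 h1 e hd v]
    refine Finset.sum_congr rfl fun k _ => ?_
    have := norm_ne_zero_iff.2 (hd k)
    rw [hμ, inner_smul_right, real_inner_self_eq_norm_sq]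
    field_simp
  have hpos : ∀ᶠ c : ℝ in nhds 0, ∀ k, 0 ≤ 1 + c * μ k := by
    refine Filter.eventually_all.2 fun k => ?_
    have hc : Filter.Tendsto (fun c : ℝ => 1 + c * μ k) (nhds 0) (nhds 1) := by
      have : Continuous fun c : ℝ => 1 + c * μ k := by fun_prop
      simpa using this.tendsto 0
    exact hc.eventually_const_le zero_lt_one
  obtain ⟨δ, hδ, hball⟩ := Metric.eventually_nhds_iff.1 ((eventually_mem_Ioo h0 h1 v).and hpos)
  refine ⟨v, hv0, δ, hδ, fun c hc => ?_⟩
  obtain ⟨hc1, hc2⟩ := hball (y := c) (by rw [dist_zero_right, Real.norm_eq_abs]; exact abs_lt.2 hc)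
  have hq : ∀ k, q k + (c * v k) • C.sideVec k =
      C.vert k + (t k + c * v k) • C.sideVec k := fun k => by rw [e k, add_smul, add_assoc]
  have hlen : pathLength (fun k => q k + (c * v k) • C.sideVec k) = pathLength q := by
    have : ∀ k, dist (q k + (c * v k) • C.sideVec k)
        (q (k + 1) + (c * v (k + 1)) • C.sideVec (k + 1)) =
        dist (q k) (q (k + 1)) + c * (μ k * ‖q (k + 1) - q k‖) := by
      intro k
      rw [dist_comm, dist_eq_norm, path_add_step_eq, hμ, smul_smul, dist_comm (q k), dist_eq_norm,
        show ∀ (d : Plane) (r : ℝ), d + r • d = (1 + r) • d from fun d r => by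
          rw [add_smul, one_smul], norm_smul, Real.norm_of_nonneg (hc2 k)]
      ring
    simp only [pathLength, this]
    rw [Finset.sum_add_distrib, ← Finset.mul_sum, hsum, mul_zero, add_zero]
  refine ⟨⟨fun k => ?_, fun q' hq' => hlen ▸ h.le q' hq'⟩, fun k j => ?_⟩
  · rw [hq]
    exact C.mem_side_iff.2 ⟨_, (hc1 k).1.le, (hc1 k).2.le, rfl⟩
  · rw [hq]
    exact C.add_smul_sideVec_ne_vert (hc1 k).1 (hc1 k).2 j

/-- The hull of points in the open sides of `C` meets each side in the chosen point only, so it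
determines these points. -/
lemma eq_of_mem_convexHull {C : ConvexPolygon n} {q : ZMod n → Plane}
    (hq : ∀ k, q k ∈ C.side k) (hv : ∀ k j, q k ≠ C.vert j) {k : ZMod n} {x : Plane}
    (hx : x ∈ C.side k) (hxq : x ∈ convexHull ℝ (Set.range q)) : x = q k := by
  let f : Plane → ℝ := orient (C.vert k) (C.vert (k + 1))
  have hf : ∀ (x y : Plane) (a b : ℝ), a + b = 1 → f (a • x + b • y) = a * f x + b * f y := by
    intro x y a b hab
    obtain rfl : a = 1 - b := by linarith
    simp only [f, orient_eq, PiLp.add_apply, PiLp.smul_apply, smul_eq_mul]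
    ring
  have hk : f (q k) = 0 := C.orient_eq_zero_of_mem_side (hq k)
  have hconv : Convex ℝ {y | 0 < f y ∨ y = q k} := by
    rw [convex_iff_forall_pos]
    rintro y hy z hz a b ha hb hab
    have e := hf y z a b hab
    rcases hy with hy | rfl <;> rcases hz with hz | rfl
    · exact Or.inl (by rw [e]; positivity)
    · exact Or.inl (by rw [e, hk]; simpa using mul_pos ha hy)
    · exact Or.inl (by rw [e, hk]; simpa using mul_pos hb hz)
    · exact Or.inr (by rw [← add_smul, hab, one_smul])
  have hsub : Set.range q ⊆ {y | 0 < f y ∨ y = q k} := by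
    rintro _ ⟨j, rfl⟩
    by_cases hjk : j = k
    · exact Or.inr (by rw [hjk])
    refine Or.inl ?_
    have h1 : 0 ≤ f (C.vert j) := C.orient_side_nonneg _ _
    have h2 : 0 ≤ f (C.vert (j + 1)) := C.orient_side_nonneg _ _
    simp only [f] at h1 h2 ⊢
    rw [← orient_rotate] at h1 h2 ⊢
    by_cases h3 : j = k + 1
    · refine orient_pos_of_mem_segment_right (hq j) (hv _ _) h1 ?_
      have h3' := C.three_le
      have := C.orient_vert_pos k (j := 1) (k := 2) (by omega) (by omega) (by omega)
      rw [orient_rotate, h3, add_assoc, one_add_one_eq_two]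
      simpa using this
    · refine orient_pos_of_mem_segment_left (hq j) (hv _ _) ?_ h2
      rw [orient_rotate]
      exact C.orient_side_pos hjk h3
  refine (convexHull_min hsub hconv hxq).resolve_left fun h => ?_
  exact h.ne' (C.orient_eq_zero_of_mem_side hx)

/-- For even `n`, a single minimum perimeter polygon that uses no vertex of `C` gives rise to
infinitely many. -/
lemma IsMinPerim.infinite (hn : 5 ≤ n) (he : Even n) {C : ConvexPolygon n}
    {Q : ConvexPolygon m} (hQ : Q.IsMinPerim C) (hN : ∀ k j, Q.vert j ≠ C.vert k) :
    (C.minPerimWithSeq fun _ => UseLetter.N).Infinite := by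
  have := C.neZero
  choose g hg using hQ.1
  obtain ⟨v, hv0, δ, hδ, hfam⟩ := (hQ.isShortestPath hn hg).exists_family he
    fun k j => hN j (g k)
  let q : ℝ → ZMod n → Plane := fun c k => Q.vert (g k) + (c * v k) • C.sideVec k
  have hfam : ∀ c ∈ Set.Ioo (-δ) δ, C.IsShortestPath (q c) ∧ ∀ k j, q c k ≠ C.vert j := hfam
  refine Set.infinite_of_injOn_mapsTo (s := Set.Ioo (-δ) δ)
    (f := fun c => convexHull ℝ (Set.range (q c))) ?_ ?_ (Set.Ioo_infinite (by linarith))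
  · intro c hc c' hc' hcc
    obtain ⟨hs, hv⟩ := hfam c hc
    have hmem : q c' 0 ∈ convexHull ℝ (Set.range (q c)) := by
      rw [show convexHull ℝ (Set.range (q c)) = convexHull ℝ (Set.range (q c')) from hcc]
      exact subset_convexHull ℝ _ ⟨0, rfl⟩
    have h := eq_of_mem_convexHull hs.mem_side hv ((hfam c' hc').1.mem_side 0) hmem
    have h2 := smul_left_injective ℝ (C.sideVec_ne_zero 0) (add_left_cancel h)
    exact (mul_right_cancel₀ (hv0 0) h2).symm
  · intro c hc
    obtain ⟨hs, hv⟩ := hfam c hc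
    obtain ⟨m', Q', hQ', hr⟩ := hs.exists_polygon hn hv
    refine ⟨m', Q', hQ', assocSeq_eq_N_iff.2 fun k j hj => ?_, by rw [region, hr]⟩
    obtain ⟨l, hl⟩ : Q'.vert j ∈ Set.range (q c) := hr ▸ ⟨j, rfl⟩
    exact hv l k (hl.trans hj)

end ConvexPolygon

theorem theorem3p2 (n : ℕ) (hn : 5 ≤ n) (C : ConvexPolygon n) (s : ZMod n → UseLetter) :
    ((Odd n ∨ s ≠ fun _ => UseLetter.N) → (C.minPerimWithSeq s).Subsingleton) ∧
    (Even n → (s = fun _ => UseLetter.N) →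
      C.minPerimWithSeq s = ∅ ∨
      ((C.minPerimWithSeq s).Infinite ∧
        ∀ (m₁ m₂ : ℕ) (Q₁ : ConvexPolygon m₁) (Q₂ : ConvexPolygon m₂),
          Q₁.IsMinPerim C → Q₂.IsMinPerim C → C.assocSeq Q₁ = s → C.assocSeq Q₂ = s →
          ∃ (e₁ : ZMod n ≃ ZMod m₁) (e₂ : ZMod n ≃ ZMod m₂),
            C.IsSideMatching Q₁ e₁ ∧ C.IsSideMatching Q₂ e₂ ∧
            ∀ k : ZMod n, Q₁.sideLine (e₁ k) ∥ Q₂.sideLine (e₂ k))) := by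
  refine ⟨C.minPerimWithSeq_subsingleton hn s, ?_⟩
  rintro he rfl
  rcases (C.minPerimWithSeq fun _ => UseLetter.N).eq_empty_or_nonempty with h | ⟨_, m, Q, hQ, hN, -⟩
  · exact Or.inl h
  · exact Or.inr ⟨hQ.infinite hn he (ConvexPolygon.assocSeq_eq_N_iff.1 hN),
      fun m₁ m₂ Q₁ Q₂ h₁ h₂ hs₁ hs₂ => h₁.exists_sideMatching hn h₂
        (ConvexPolygon.assocSeq_eq_N_iff.1 hs₁) (ConvexPolygon.assocSeq_eq_N_iff.1 hs₂)⟩
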